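/- Let $m\ge 1$ and let $\Omega\subseteq\mathbb C^m$ be a domain (non-empty, open, connected). Write $\Omega^*=\{\bar w: w\in\Omega\}$. A function on $U\times U$ ($U\subseteq\mathbb C^m$ open) is called sesqui-holomorphic if it is holomorphic in the first variable and anti-holomorphic in the second. A function $L:U\times U\to\mathbb C^{d\times d}$ is called positive definite on $U$ if $\sum_{i,j=1}^n\langle L(u_i,u_j)\xi_j,\xi_i\rangle\ge 0$ for all $n$, all $u_1,\dots,u_n\in U$ and all $\xi_1,\dots,\xi_n\in\mathbb C^d$. A function $G:U\to\mathbb C^{d\times d}$ is called a positive definite function on $U$ if it has a sesqui-holomorphic extension (polarization) $\widetilde G$ to $U\times U$, $\widetilde G(w,w)=G(w)$ for $w\in U$, and $\widetilde G$ is positive definite on $U$. A function $F:U\times U\to\mathbb C$ is called infinitely divisible on $U$ if there is a sesqui-holomorphic branch $\log F$ of its logarithm on $U\times U$, real on the diagonal, such that $F^t=\exp(t\log F)$ is positive definite on $U$ for every real $t>0$. A commuting $m$-tuple $T=(T_1,\dots,T_m)$ of bounded operators on a Hilbert space $\mathcal H$ belongs to the Cowen--Douglas class $B_1(\Omega^*)$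 if for every $w\in\Omega^*$ the operator $D_{T-w}:\mathcal H\to\mathcal H\oplus\dots\oplus\mathcal H$, $x\mapsto((T_1-w_1)x,\dots,(T_m-w_m)x)$, has closed range and a one-dimensional kernel, and if the linear span of $\bigcup_{w\in\Omega^*}\ker D_{T-w}$ is dense in $\mathcal H$. Theorem. Let $\mathcal H_K$ be a Hilbert space of holomorphic functions on $\Omega$ with a sesqui-holomorphic reproducing kernel $K$ such that $K(w,w)\neq 0$ for all $w\in\Omega$. Assume that the multiplication operators $M_1,\dots,M_m$ by the coordinate functions are bounded on $\mathcal H_K$ and that $M^*=(M_1^*,\dots,M_m^*)$ belongs to $B_1(\Omega^*)$. Let $\mathfrak K$ be a sesqui-holomorphic positive definite kernel on $\Omega$ with $\mathfrak K(w,w)\ne 0$ for all $w\in\Omega$. Then the matrix valued function $$w\mapsto\Big(\frac{\partial^2}{\partial w_i\,\partial\bar w_j}\log\big(\mathfrak K(w,w)^{-1}K(w,w)\big)\Big)_{i,j=1}^m$$ is a positive definite function on $\Omega$ if and only if there is a non-empty open set $\Omega_0\subseteq\Omega$ on which $\mathfrak K(z,w)^{-1}K(z,w)$ is infinitely divisible.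 -/

import Mathlib

open scoped ComplexOrder

noncomputable section

namespace CowenDouglas

/-- A function `f(z, w)` is sesqui-holomorphic on `Ω × Ω`: holomorphic in `z` and anti-holomorphic
in `w`, that is, `(z, v) ↦ f(z, v̄)` is holomorphic on `Ω × Ω*`, where `Ω* = {v : v̄ ∈ Ω}`. -/
def IsSesquiholomorphic {m : ℕ} (Ω : Set (Fin m → ℂ))
    (f : (Fin m → ℂ) → (Fin m → ℂ) → ℂ) : Prop :=
  DifferentiableOn ℂ (fun p : (Fin m → ℂ) × (Fin m → ℂ) => f p.1 (star p.2))
    {p | p.1 ∈ Ω ∧ star p.2 ∈ Ω}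

/-- A scalar function `K` is positive definite on `Ω`: all matrices `(K(u_i, u_j))` with
`u_1, …, u_n ∈ Ω` are positive (in the sense `≥ 0`). -/
def IsPosDefKernel {m : ℕ} (Ω : Set (Fin m → ℂ))
    (K : (Fin m → ℂ) → (Fin m → ℂ) → ℂ) : Prop :=
  ∀ (n : ℕ) (u : Fin n → Fin m → ℂ), (∀ i, u i ∈ Ω) →
    (Matrix.of fun i j : Fin n => K (u i) (u j)).PosSemidef

/-- A matrix valued function `L` is positive definite on `Ω`: all block matrices `(L(u_i, u_j))`
with `u_1, …, u_n ∈ Ω` are positive, i.e. `∑ ⟨L(u_i, u_j) ξ_j, ξ_i⟩ ≥ 0` for all `ξ_i ∈ ℂ^d`. -/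
def IsPosDefMatrixKernel {m d : ℕ} (Ω : Set (Fin m → ℂ))
    (L : (Fin m → ℂ) → (Fin m → ℂ) → Matrix (Fin d) (Fin d) ℂ) : Prop :=
  ∀ (n : ℕ) (u : Fin n → Fin m → ℂ), (∀ i, u i ∈ Ω) →
    (Matrix.of fun p q : Fin n × Fin d => L (u p.1) (u q.1) p.2 q.2).PosSemidef

/-- A matrix valued function `G` on `Ω` is a positive definite function on `Ω`: it is the
restriction to the diagonal of a sesqui-holomorphic function on `Ω × Ω` (its polarization),
and this polarization is positive definite. -/
def IsPosDefFunction {m d : ℕ} (Ω : Set (Fin m → ℂ))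
    (G : (Fin m → ℂ) → Matrix (Fin d) (Fin d) ℂ) : Prop :=
  ∃ L : (Fin m → ℂ) → (Fin m → ℂ) → Matrix (Fin d) (Fin d) ℂ,
    (∀ k l, IsSesquiholomorphic Ω fun z w => L z w k l) ∧
    (∀ w ∈ Ω, L w w = G w) ∧
    IsPosDefMatrixKernel Ω L

/-- `ℓ` is a sesqui-holomorphic branch of `log F` on `Ω × Ω` that is real on the diagonal. -/
def IsLogBranch {m : ℕ} (Ω : Set (Fin m → ℂ))
    (F ℓ : (Fin m → ℂ) → (Fin m → ℂ) → ℂ) : Prop :=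
  IsSesquiholomorphic Ω ℓ ∧
    (∀ z ∈ Ω, ∀ w ∈ Ω, Complex.exp (ℓ z w) = F z w) ∧
    ∀ w ∈ Ω, (ℓ w w).im = 0

/-- `F` is infinitely divisible on `Ω`: the powers `F^t = exp (t log F)` are positive definite on
`Ω` for all real `t > 0`. -/
def IsInfinitelyDivisible {m : ℕ} (Ω : Set (Fin m → ℂ))
    (F : (Fin m → ℂ) → (Fin m → ℂ) → ℂ) : Prop :=
  ∃ ℓ : (Fin m → ℂ) → (Fin m → ℂ) → ℂ, IsLogBranch Ω F ℓ ∧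
    ∀ t : ℝ, 0 < t → IsPosDefKernel Ω fun z w => Complex.exp ((t : ℂ) * ℓ z w)

/-- The Wirtinger derivative `∂g/∂w_i = (∂g/∂x_i - i ∂g/∂y_i) / 2`, where `w_i = x_i + i y_i`. -/
def wirtinger {m : ℕ} (i : Fin m) (g : (Fin m → ℂ) → ℂ) (w : Fin m → ℂ) : ℂ :=
  (fderiv ℝ g w (Pi.single i 1) - Complex.I * fderiv ℝ g w (Pi.single i Complex.I)) / 2

/-- The Wirtinger derivative `∂g/∂w̄_i = (∂g/∂x_i + i ∂g/∂y_i) / 2`, where `w_i = x_i + i y_i`. -/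
def wirtingerBar {m : ℕ} (i : Fin m) (g : (Fin m → ℂ) → ℂ) (w : Fin m → ℂ) : ℂ :=
  (fderiv ℝ g w (Pi.single i 1) + Complex.I * fderiv ℝ g w (Pi.single i Complex.I)) / 2

/-- The matrix `(∂²g / ∂w_i ∂w̄_j)`. -/
def complexHessian {m : ℕ} (g : (Fin m → ℂ) → ℂ) (w : Fin m → ℂ) :
    Matrix (Fin m) (Fin m) ℂ :=
  Matrix.of fun i j => wirtinger i (wirtingerBar j g) w

section Operators

variable {m : ℕ} {H : Type*} [NormedAddCommGroup H] [InnerProductSpace ℂ H]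

/-- The operator `D_{T - w} : H → H ⊕ ⋯ ⊕ H`, `x ↦ ((T_1 - w_1) x, …, (T_m - w_m) x)`. -/
def jointOperator (T : Fin m → H →L[ℂ] H) (w : Fin m → ℂ) : H →L[ℂ] (Fin m → H) :=
  ContinuousLinearMap.pi fun i => T i - w i • ContinuousLinearMap.id ℂ H

/-- The commuting tuple `T` belongs to the Cowen-Douglas class `B_n(Ω)`. -/
structure IsCowenDouglas (n : ℕ) (Ω : Set (Fin m → ℂ)) (T : Fin m → H →L[ℂ] H) : Prop where
  commute : ∀ i j, Commute (T i) (T j)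
  isClosed_range : ∀ w ∈ Ω, IsClosed (Set.range (jointOperator T w))
  rank_ker : ∀ w ∈ Ω, Module.rank ℂ (LinearMap.ker (jointOperator T w).toLinearMap) = n
  dense_span : Dense
    (Submodule.span ℂ {x : H | ∃ w ∈ Ω, jointOperator T w x = 0} : Set H)

end Operators

end CowenDouglas

end

/-! Let ℓ be a local sesqui-holomorphic logarithm of 𝔎⁻¹K. Both conditions amount to conditional
positive definiteness of ℓ, that is, positive definiteness of ℓ(z,w) - ℓ(z,w₀) - ℓ(w₀,w) + ℓ(w₀,w₀)
(`doubleDifference`).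

Hessian to powers: near w₀ the principal logarithm serves as ℓ, and the polarization of the Hessian
is the kernel of mixed derivatives ∂ₖ∂̄ₗℓ (`eq_zero_of_diag_eq_zero`). A positive definite such
kernel is the Gram kernel of holomorphic Hilbert space valued maps φₖ (`exists_holomorphic_gram`).
Integrating Σ φₖ dzₖ along segments from w₀ gives vectors whose Gram kernel is the double difference
(`inner_integral_segmentDeriv`), and Schoenberg's argument exponentiates it (`isPosDefKernel_exp`).

Powers to Hessian: differentiating exp(tℓ) at t = 0 makes the double difference positive, so it
equals ⟨ψ(w), ψ(z)⟩ with ψ holomorphic, and the vectors ∂ₖψ have Gram kernel ∂ₖ∂̄ₗℓ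
(`inner_fderiv_fderiv`). This holds only on a small ball and must be carried to all of Ω. There
∂ₖ∂̄ₗ log(K/𝔎) is a quotient N/D with N, D sesqui-holomorphic on Ω × Ω and D nonzero on the
diagonal. The vector maps themselves are continued, not the inequality: Cauchy's estimates for the
Gram function bound the Taylor coefficients of the vectors (`exists_extension_disc_of_gram`), and
the Gram relation forces continuations to agree wherever their domains meet
(`eqOn_inter_of_gram_relation`). The continued family lives on Ω, and its Gram kernel is the
required positive definite polarization. -/

namespace CowenDouglas

open Metric Filter Topology Set

/-! ### Holomorphic maps on normed spaces: Cauchy estimates, bounded limits, identity theorem. -/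

section Holomorphic

variable {E F : Type*} [NormedAddCommGroup E] [NormedSpace ℂ E]
  [NormedAddCommGroup F] [NormedSpace ℂ F]

/-- The complex line through `p` in the direction `v`. -/
def line (p v : E) (ζ : ℂ) : E := p + ζ • v

lemma hasDerivAt_line (p v : E) (ζ : ℂ) : HasDerivAt (line p v) v ζ := by
  have := ((hasDerivAt_id ζ).smul_const v).const_add p
  rwa [one_smul] at this

@[fun_prop]
lemma differentiable_line (p v : E) : Differentiable ℂ (line p v) :=
  fun ζ => (hasDerivAt_line p v ζ).differentiableAt

@[fun_prop]
lemma continuous_line (p v : E) : Continuous (line p v) := (differentiable_line p v).continuous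

@[simp] lemma line_zero (p v : E) : line p v 0 = p := by simp [line]

lemma line_mem_ball {p v : E} {ρ R : ℝ} (h : ρ * ‖v‖ < R) {ζ : ℂ} (hζ : ‖ζ‖ ≤ ρ) :
    line p v ζ ∈ ball p R := by
  simp only [line, mem_ball, dist_self_add_left, norm_smul]
  exact lt_of_le_of_lt (mul_le_mul_of_nonneg_right hζ (norm_nonneg v)) h

lemma convex_preimage_line (p v : E) {S : Set E} (hS : Convex ℝ S) :
    Convex ℝ (line p v ⁻¹' S) := by
  intro x hx y hy a b ha hb hab
  have := hS hx hy ha hb hab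
  simp only [mem_preimage, line] at this ⊢
  convert this using 1
  rw [smul_add, smul_add, add_add_add_comm, ← add_smul, hab, one_smul, add_smul, smul_assoc,
    smul_assoc]

lemma hasDerivAt_comp_line {f : E → F} {p v : E} {ζ : ℂ}
    (hf : DifferentiableAt ℂ f (line p v ζ)) :
    HasDerivAt (fun ζ => f (line p v ζ)) (fderiv ℂ f (line p v ζ) v) ζ :=
  hf.hasFDerivAt.comp_hasDerivAt ζ (hasDerivAt_line p v ζ)

lemma deriv_line_zero {f : E → F} {p v : E} (hf : DifferentiableAt ℂ f p) :
    deriv (fun ζ => f (line p v ζ)) 0 = fderiv ℂ f p v := by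
  have := (hasDerivAt_comp_line (v := v) (ζ := 0) (f := f) (p := p) (by simpa using hf)).deriv
  simpa using this

/-- The first-order Cauchy estimate for a bounded holomorphic function on a ball. -/
lemma norm_fderiv_apply_le {f : E → F} {z v : E} {R C : ℝ} (hR : 0 < R)
    (hf : DifferentiableOn ℂ f (ball z R)) (hC : ∀ x ∈ ball z R, ‖f x‖ ≤ C) :
    ‖fderiv ℂ f z v‖ ≤ 2 * C * ‖v‖ / R := by
  rcases eq_or_ne v 0 with rfl | hv
  · simp
  have hv' : 0 < ‖v‖ := norm_pos_iff.mpr hv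
  set ρ := R / (2 * ‖v‖) with hρ
  have hρ0 : 0 < ρ := by positivity
  have hρv : ρ * ‖v‖ < R := by rw [hρ]; field_simp; linarith
  have hd : DifferentiableOn ℂ (fun ζ => f (line z v ζ)) (closedBall 0 ρ) :=
    hf.comp (differentiable_line z v).differentiableOn fun ζ hζ =>
      line_mem_ball hρv (by simpa using hζ)
  rw [← deriv_line_zero (hf.differentiableAt (ball_mem_nhds z hR))]
  refine (Complex.norm_deriv_le_of_forall_mem_sphere_norm_le hρ0
    (hd.diffContOnCl_ball le_rfl) (C := C) fun ζ hζ => hC _ (line_mem_ball hρv ?_)).trans_eq ?_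
  · simpa using (mem_sphere.mp hζ).le
  · rw [hρ]; field_simp

/-- The second-order Cauchy estimate for a bounded holomorphic function on a ball. -/
lemma norm_sub_sub_fderiv_le [CompleteSpace F] {f : E → F} {z v : E} {R C : ℝ} (hR : 0 < R)
    (hf : DifferentiableOn ℂ f (ball z R)) (hC : ∀ x ∈ ball z R, ‖f x‖ ≤ C) (hv4 : ‖v‖ ≤ R / 4) :
    ‖f (z + v) - f z - fderiv ℂ f z v‖ ≤ 8 * C * ‖v‖ ^ 2 / R ^ 2 := by
  rcases eq_or_ne v 0 with rfl | hv
  · simp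
  have hC0 : 0 ≤ C := (norm_nonneg _).trans (hC z (mem_ball_self hR))
  have hv' : 0 < ‖v‖ := norm_pos_iff.mpr hv
  -- The disc of radius ρ is mapped into the ball of radius R / 2, and ρ ≥ 2 puts ζ = 1 well inside,
  -- so the Taylor tail is dominated by a geometric series of ratio at most 1/2.
  set ρ := R / (2 * ‖v‖) with hρ
  have hρ2 : 2 ≤ ρ := by rw [hρ, le_div_iff₀ (by positivity)]; linarith
  have hρ0 : 0 < ρ := by positivity
  have hρv : ρ * ‖v‖ < R := by rw [hρ]; field_simp; linarith
  set g : ℂ → F := fun ζ => f (line z v ζ)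
  have hd : DifferentiableOn ℂ g (closedBall 0 ρ) :=
    hf.comp (differentiable_line z v).differentiableOn fun ζ hζ =>
      line_mem_ball hρv (by simpa using hζ)
  have hsum := Complex.hasSum_taylorSeries_on_ball (c := 0) (z := 1) (f := g) (r := ρ)
    (hd.mono ball_subset_closedBall) (by simp; linarith)
  have hsum2 := (hasSum_nat_add_iff' 2).mpr hsum
  have h01 : g 1 - ∑ i ∈ Finset.range 2,
      ((i.factorial : ℂ)⁻¹ • ((1 : ℂ) - 0) ^ i • iteratedDeriv i g 0) =
      f (z + v) - f z - fderiv ℂ f z v := by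
    have h1 : deriv g 0 = fderiv ℂ f z v :=
      deriv_line_zero (hf.differentiableAt (ball_mem_nhds z hR))
    have h2 : g 1 = f (z + v) := by simp [g, line]
    have h3 : g 0 = f z := by simp [g]
    simp [Finset.sum_range_succ, h1, h2, h3, sub_sub]
  rw [h01] at hsum2
  have hgeo : HasSum (fun n : ℕ => C * ρ⁻¹ ^ 2 * ρ⁻¹ ^ n) (C * ρ⁻¹ ^ 2 * (1 - ρ⁻¹)⁻¹) :=
    (hasSum_geometric_of_lt_one (by positivity) (inv_lt_one_of_one_lt₀ (by linarith))).mul_left _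
  have hle : ‖f (z + v) - f z - fderiv ℂ f z v‖ ≤ C * ρ⁻¹ ^ 2 * (1 - ρ⁻¹)⁻¹ := by
    refine hsum2.norm_le_of_bounded hgeo fun n => ?_
    have := Complex.norm_iteratedDeriv_le_of_forall_mem_sphere_norm_le (n + 2) hρ0
      (hd.diffContOnCl_ball le_rfl) (C := C) fun ζ hζ => hC _ (line_mem_ball hρv (by
        simpa using (mem_sphere.mp hζ).le))
    rw [norm_smul]
    simp only [sub_zero, one_pow, one_smul, norm_inv, Complex.norm_natCast]
    calc _ ≤ ((n + 2).factorial : ℝ)⁻¹ * ((n + 2).factorial * C / ρ ^ (n + 2)) := by gcongr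
      _ = C * ρ⁻¹ ^ 2 * ρ⁻¹ ^ n := by
        have : ((n + 2).factorial : ℝ) ≠ 0 := by positivity
        rw [inv_pow, inv_pow, pow_add]
        field_simp
  refine hle.trans ?_
  have h2 : (1 - ρ⁻¹)⁻¹ ≤ 2 := by
    have : ρ⁻¹ ≤ 2⁻¹ := inv_anti₀ (by norm_num) hρ2
    calc (1 - ρ⁻¹)⁻¹ ≤ (2⁻¹ : ℝ)⁻¹ := inv_anti₀ (by norm_num) (by linarith)
      _ = 2 := by norm_num
  calc C * ρ⁻¹ ^ 2 * (1 - ρ⁻¹)⁻¹ ≤ C * ρ⁻¹ ^ 2 * 2 := by gcongr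
    _ = 8 * C * ‖v‖ ^ 2 / R ^ 2 := by rw [hρ]; field_simp; ring

/-- A pointwise limit of uniformly bounded holomorphic functions is holomorphic. -/
theorem differentiableAt_of_tendsto_of_bounded [CompleteSpace F] {ι : Type*} {l : Filter ι}
    [l.NeBot] {f : ι → E → F} {g : E → F} {z : E} {R C : ℝ} (hR : 0 < R)
    (hf : ∀ᶠ i in l, DifferentiableOn ℂ (f i) (ball z R) ∧ ∀ x ∈ ball z R, ‖f i x‖ ≤ C)
    (hg : ∀ x ∈ ball z R, Tendsto (fun i => f i x) l (𝓝 (g x))) :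
    DifferentiableAt ℂ g z := by
  have hC0 : 0 ≤ C := by
    obtain ⟨i, hi⟩ := hf.exists
    exact (norm_nonneg _).trans (hi.2 z (mem_ball_self hR))
  have hlim : ∀ v : E, ∃ d, Tendsto (fun i => fderiv ℂ (f i) z v) l (𝓝 d) := by
    intro v
    rcases eq_or_ne v 0 with rfl | hv
    · exact ⟨0, by simp⟩
    have hv' : 0 < ‖v‖ := norm_pos_iff.mpr hv
    refine cauchy_map_iff_exists_tendsto.mp ?_
    rw [Metric.cauchy_iff]
    refine ⟨inferInstance, fun ε hε => ?_⟩
    -- For this t the difference quotient is within ε / 4 of the derivative for all relevant i at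
    -- once. Since the quotients converge as i varies, the derivatives are Cauchy.
    obtain ⟨t, ht0, ht1, ht2⟩ : ∃ t : ℝ, 0 < t ∧ t * ‖v‖ ≤ R / 4 ∧
        8 * C * t * ‖v‖ ^ 2 / R ^ 2 < ε / 4 := by
      have h1 : ∀ᶠ t : ℝ in 𝓝[>] 0, t * ‖v‖ ≤ R / 4 := by
        have : Tendsto (fun t : ℝ => t * ‖v‖) (𝓝[>] 0) (𝓝 (0 * ‖v‖)) :=
          ((continuous_id.mul continuous_const).tendsto 0).mono_left nhdsWithin_le_nhds
        exact (this.eventually (gt_mem_nhds (by simp; positivity))).mono fun _ h => h.le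
      have h2 : ∀ᶠ t : ℝ in 𝓝[>] 0, 8 * C * t * ‖v‖ ^ 2 / R ^ 2 < ε / 4 := by
        have : Tendsto (fun t : ℝ => 8 * C * t * ‖v‖ ^ 2 / R ^ 2) (𝓝[>] 0)
            (𝓝 (8 * C * 0 * ‖v‖ ^ 2 / R ^ 2)) :=
          ((by fun_prop : Continuous fun t : ℝ => 8 * C * t * ‖v‖ ^ 2 / R ^ 2).tendsto 0).mono_left
            nhdsWithin_le_nhds
        exact this.eventually (gt_mem_nhds (by simp; positivity))
      obtain ⟨t, ⟨h1, h2⟩, h3⟩ := ((h1.and h2).and self_mem_nhdsWithin).exists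
      exact ⟨t, h3, h1, h2⟩
    have htv : ‖(t : ℂ) • v‖ = t * ‖v‖ := by simp [norm_smul, abs_of_pos ht0]
    have hmem : z + (t : ℂ) • v ∈ ball z R := by
      simp only [mem_ball, dist_self_add_left, htv]; linarith
    have hq : Tendsto (fun i => (t : ℂ)⁻¹ • (f i (z + (t : ℂ) • v) - f i z)) l
        (𝓝 ((t : ℂ)⁻¹ • (g (z + (t : ℂ) • v) - g z))) :=
      ((hg _ hmem).sub (hg z (mem_ball_self hR))).const_smul _
    have hnear : ∀ᶠ i in l, dist (fderiv ℂ (f i) z v)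
        ((t : ℂ)⁻¹ • (g (z + (t : ℂ) • v) - g z)) < ε / 2 := by
      filter_upwards [hf, hq.eventually (ball_mem_nhds _ (show 0 < ε / 4 by positivity))]
        with i hi hi2
      have := norm_sub_sub_fderiv_le (v := (t : ℂ) • v) hR hi.1 hi.2 (by rw [htv]; exact ht1)
      have h3 : ‖(t : ℂ)⁻¹ • (f i (z + (t : ℂ) • v) - f i z) - fderiv ℂ (f i) z v‖ < ε / 4 := by
        have ht0' : (t : ℂ) ≠ 0 := by exact_mod_cast ht0.ne'
        have heq : (t : ℂ)⁻¹ • (f i (z + (t : ℂ) • v) - f i z) - fderiv ℂ (f i) z v =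
            (t : ℂ)⁻¹ • (f i (z + (t : ℂ) • v) - f i z - fderiv ℂ (f i) z ((t : ℂ) • v)) := by
          rw [map_smul, smul_sub (t : ℂ)⁻¹ (f i (z + (t : ℂ) • v) - f i z),
            inv_smul_smul₀ ht0']
        rw [heq, norm_smul, norm_inv, Complex.norm_real, Real.norm_of_nonneg ht0.le]
        refine lt_of_le_of_lt (mul_le_mul_of_nonneg_left this (by positivity)) ?_
        rw [htv]
        refine lt_of_eq_of_lt ?_ ht2
        field_simp
      have h4 := mem_ball.mp hi2
      rw [← dist_eq_norm, dist_comm] at h3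
      linarith [dist_triangle (fderiv ℂ (f i) z v)
        ((t : ℂ)⁻¹ • (f i (z + (t : ℂ) • v) - f i z)) ((t : ℂ)⁻¹ • (g (z + (t : ℂ) • v) - g z))]
    refine ⟨_, image_mem_map hnear, ?_⟩
    rintro _ ⟨i, hi, rfl⟩ _ ⟨j, hj, rfl⟩
    have h1 : dist _ _ < _ := hi
    have h2 : dist _ _ < _ := hj
    rw [dist_comm] at h2
    linarith [dist_triangle (fderiv ℂ (f i) z v) ((t : ℂ)⁻¹ • (g (z + (t : ℂ) • v) - g z))
      (fderiv ℂ (f j) z v)]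
  choose d hd using hlim
  let D : E →L[ℂ] F := LinearMap.mkContinuous
    { toFun := d
      map_add' := fun v w => tendsto_nhds_unique (hd (v + w)) (by
        simpa only [map_add] using (hd v).add (hd w))
      map_smul' := fun c v => tendsto_nhds_unique (hd (c • v)) (by
        simpa only [map_smul, RingHom.id_apply] using (hd v).const_smul c) } (2 * C / R) (fun v => by
      refine le_of_tendsto (hd v).norm (hf.mono fun i hi => ?_)
      refine (norm_fderiv_apply_le hR hi.1 hi.2).trans_eq (by ring))
  have hbound : ∀ v : E, ‖v‖ ≤ R / 4 → ‖g (z + v) - g z - D v‖ ≤ 8 * C / R ^ 2 * ‖v‖ ^ 2 := by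
    intro v hv
    have hmem : z + v ∈ ball z R := by
      simp only [mem_ball, dist_self_add_left]; linarith
    have : Tendsto (fun i => f i (z + v) - f i z - fderiv ℂ (f i) z v) l
        (𝓝 (g (z + v) - g z - D v)) :=
      ((hg _ hmem).sub (hg z (mem_ball_self hR))).sub (hd v)
    refine le_of_tendsto this.norm (hf.mono fun i hi => ?_)
    refine (norm_sub_sub_fderiv_le hR hi.1 hi.2 hv).trans_eq (by ring)
  refine HasFDerivAt.differentiableAt (f' := D) ?_
  rw [hasFDerivAt_iff_isLittleO_nhds_zero]
  have hO : (fun v : E => g (z + v) - g z - D v) =O[𝓝 0] fun v => ‖v‖ ^ 2 := by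
    refine Asymptotics.IsBigO.of_bound (8 * C / R ^ 2) ?_
    filter_upwards [closedBall_mem_nhds (0 : E) (show 0 < R / 4 by positivity)] with v hv
    simpa using hbound v (by simpa using hv)
  refine hO.trans_isLittleO ?_
  have := Asymptotics.isLittleO_norm_pow_id (E' := E) (n := 2) (by norm_num)
  simpa using this

/-- Directional derivatives of holomorphic functions are holomorphic. -/
theorem differentiableOn_fderiv_apply [CompleteSpace F] {f : E → F} {U : Set E} (hU : IsOpen U)
    (hf : DifferentiableOn ℂ f U) (v : E) : DifferentiableOn ℂ (fun z => fderiv ℂ f z v) U := by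
  intro z hz
  refine DifferentiableAt.differentiableWithinAt ?_
  obtain ⟨R, hR, hRU, hRC⟩ : ∃ R > 0, ball z R ⊆ U ∧ ∀ x ∈ ball z R, ‖f x‖ ≤ ‖f z‖ + 1 := by
    have h1 : ∀ᶠ x in 𝓝 z, ‖f x‖ < ‖f z‖ + 1 :=
      ((hf.differentiableAt (hU.mem_nhds hz)).continuousAt.norm).eventually
        (gt_mem_nhds (by linarith))
    obtain ⟨R, hR, h⟩ := Metric.mem_nhds_iff.mp (inter_mem (hU.mem_nhds hz) h1)
    exact ⟨R, hR, fun x hx => (h hx).1, fun x hx => (h hx).2.le⟩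
  set C := ‖f z‖ + 1 with hC
  have hC0 : 0 ≤ C := by positivity
  set r := R / 4 with hr
  have hr0 : 0 < r := by positivity
  have hsub : ∀ x ∈ ball z r, ball x (2 * r) ⊆ ball z R := fun x hx =>
    ball_subset_ball' (by have := (mem_ball.mp hx).le; linarith)
  have hsmall : ∀ᶠ t : ℂ in 𝓝[≠] 0, ‖t • v‖ < r / 2 := by
    have : Tendsto (fun t : ℂ => ‖t • v‖) (𝓝[≠] 0) (𝓝 ‖(0 : ℂ) • v‖) :=
      ((by fun_prop : Continuous fun t : ℂ => ‖t • v‖).tendsto 0).mono_left nhdsWithin_le_nhds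
    exact this.eventually (gt_mem_nhds (by simpa using by positivity))
  have hmem : ∀ x ∈ ball z r, ∀ t : ℂ, ‖t • v‖ < r / 2 → x + t • v ∈ ball z R := fun x hx t ht =>
    hsub x hx (by simp only [mem_ball, dist_self_add_left]; linarith)
  -- The directional derivative is a pointwise limit of holomorphic difference quotients, uniformly
  -- bounded because f is Lipschitz on balls of radius r by the Cauchy estimate.
  refine differentiableAt_of_tendsto_of_bounded (l := 𝓝[≠] (0 : ℂ)) (R := r)
    (f := fun t x => t⁻¹ • (f (x + t • v) - f x)) (C := 2 * C * ‖v‖ / r) hr0 ?_ ?_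
  · filter_upwards [hsmall, self_mem_nhdsWithin] with t ht ht0
    refine ⟨?_, fun x hx => ?_⟩
    · refine DifferentiableOn.const_smul (DifferentiableOn.sub ?_ ?_) _
      · exact (hf.mono hRU).comp (by fun_prop) fun x hx => hmem x hx t ht
      · exact hf.mono ((ball_subset_ball (by linarith)).trans hRU)
    · have hlip : ‖f (x + t • v) - f x‖ ≤ 2 * C / r * ‖x + t • v - x‖ := by
        refine (convex_ball x r).norm_image_sub_le_of_norm_fderiv_le (𝕜 := ℂ) (f := f)
          (fun y hy => ?_) (fun y hy => ?_) (mem_ball_self hr0) ?_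
        · exact hf.differentiableAt (hU.mem_nhds (hRU (hsub x hx
            (ball_subset_ball (by linarith) hy))))
        · have hyR : ball y r ⊆ ball z R := (ball_subset_ball' (by
            have := (mem_ball.mp hy).le; linarith)).trans (hsub x hx)
          refine ContinuousLinearMap.opNorm_le_bound _ (by positivity) fun w => ?_
          refine (norm_fderiv_apply_le hr0 ((hf.mono hRU).mono hyR)
            (fun u hu => hRC u (hyR hu))).trans_eq (by ring)
        · simp only [mem_ball, dist_self_add_left]; linarith
      have ht0' : 0 < ‖t‖ := norm_pos_iff.mpr ht0
      rw [add_sub_cancel_left, norm_smul] at hlip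
      rw [norm_smul, norm_inv]
      calc ‖t‖⁻¹ * ‖f (x + t • v) - f x‖ ≤ ‖t‖⁻¹ * (2 * C / r * (‖t‖ * ‖v‖)) := by gcongr
        _ = 2 * C * ‖v‖ / r := by field_simp
  · intro x hx
    have hx' : DifferentiableAt ℂ f x :=
      hf.differentiableAt (hU.mem_nhds (hRU (ball_subset_ball (by linarith) hx)))
    have h := hasDerivAt_comp_line (v := v) (ζ := 0) (f := f) (p := x) (by simpa using hx')
    have := h.tendsto_slope_zero
    simpa [line] using this

/-- The identity theorem for holomorphic functions on open connected sets. -/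
theorem eq_zero_of_eventuallyEq_zero [CompleteSpace F] {f : E → F} {U : Set E} (hU : IsOpen U)
    (hUc : IsPreconnected U) (hf : DifferentiableOn ℂ f U) {p : E} (hp : p ∈ U)
    (h0 : ∀ᶠ z in 𝓝 p, f z = 0) : ∀ z ∈ U, f z = 0 := by
  have hV : IsOpen {q | ∀ᶠ z in 𝓝 q, f z = 0} := isOpen_setOfPred_eventually_nhds
  have hsub := hUc.subset_of_closure_inter_subset hV ⟨p, hp, h0⟩ (by
    rintro q ⟨hq, hqU⟩
    obtain ⟨r, hr, hrU⟩ := Metric.isOpen_iff.mp hU q hqU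
    obtain ⟨p', hp', hp'q⟩ := Metric.mem_closure_iff.mp hq r hr
    rw [dist_comm] at hp'q
    filter_upwards [ball_mem_nhds q hr] with x hx
    -- The one-variable identity theorem on the slice through p', near which f vanishes, and x;
    -- convexity of the ball makes the slice connected.
    set S := line p' (x - p') ⁻¹' ball q r
    have hSo : IsOpen S := isOpen_ball.preimage (continuous_line _ _)
    have hSc : IsPreconnected S := (convex_preimage_line _ _ (convex_ball q r)).isPreconnected
    have hd : DifferentiableOn ℂ (fun ζ => f (line p' (x - p') ζ)) S :=
      (hf.mono hrU).comp (differentiable_line _ _).differentiableOn fun ζ hζ => hζ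
    have hev : (fun ζ => f (line p' (x - p') ζ)) =ᶠ[𝓝 0] 0 := by
      have : Tendsto (line p' (x - p')) (𝓝 0) (𝓝 p') := by
        simpa using (continuous_line p' (x - p')).tendsto 0
      exact this.eventually hp'
    have := (hd.analyticOnNhd hSo).eqOn_zero_of_preconnected_of_eventuallyEq_zero hSc
      (z₀ := 0) (by simpa [S] using hp'q) hev (show (1 : ℂ) ∈ S by simpa [S, line] using hx)
    simpa [line] using this)
  exact fun z hz => (hsub hz).self_of_nhds

end Holomorphic

/-! ### Weak holomorphy in Hilbert spaces. -/

section Hilbert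

variable {E H : Type*} [NormedAddCommGroup E] [NormedSpace ℂ E]
  [NormedAddCommGroup H] [InnerProductSpace ℂ H] [CompleteSpace H]

/-- A locally bounded map into a Hilbert space is holomorphic as soon as its scalar products with
the elements of a total set are holomorphic. -/
theorem differentiableAt_of_weak {f : E → H} {z : E} {R C : ℝ} (hR : 0 < R) {S : Set H}
    (hC : ∀ x ∈ ball z R, ‖f x‖ ≤ C)
    (hS : ∀ s ∈ S, DifferentiableOn ℂ (fun x => inner ℂ s (f x)) (ball z R))
    (hfS : ∀ x ∈ ball z R, f x ∈ (Submodule.span ℂ S).topologicalClosure) :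
    DifferentiableAt ℂ f z := by
  classical
  -- Projections of f onto spans of finite subsets of S are holomorphic by hypothesis, bounded by C,
  -- and converge pointwise to f because f takes values in the closed span of S.
  let U : Finset S → Submodule ℂ H := fun s => Submodule.span ℂ (Subtype.val '' (s : Set S))
  have hUfin : ∀ s, FiniteDimensional ℂ (U s) := fun s =>
    FiniteDimensional.span_of_finite ℂ (s.finite_toSet.image _)
  have hUmono : Monotone U := fun s t hst => Submodule.span_mono (image_mono (by exact_mod_cast hst))
  have hUsup : (⨆ s, U s) = Submodule.span ℂ S := by
    refine le_antisymm (iSup_le fun s => Submodule.span_mono ?_) (Submodule.span_le.mpr ?_)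
    · rintro _ ⟨x, -, rfl⟩; exact x.2
    · intro x hx
      exact (le_iSup U {⟨x, hx⟩}) (Submodule.subset_span ⟨⟨x, hx⟩, by simp, rfl⟩)
  have hcomplete : CompleteSpace (⨆ s, U s).topologicalClosure :=
    (Submodule.isClosed_topologicalClosure _).completeSpace_coe
  refine differentiableAt_of_tendsto_of_bounded (l := (atTop : Filter (Finset S))) (R := R) (C := C)
    (f := fun s x => (U s).starProjection (f x)) hR (.of_forall fun s => ⟨?_, fun x hx => ?_⟩) ?_
  · let b := stdOrthonormalBasis ℂ (U s)
    have heq : (fun x => (U s).starProjection (f x)) =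
        fun x => ∑ i, inner ℂ (b i : H) (f x) • (b i : H) := by
      ext x
      rw [b.starProjection_eq_sum_rankOne]; simp
    rw [heq]
    refine DifferentiableOn.fun_sum fun i _ => DifferentiableOn.smul_const ?_ _
    have hspan : ∀ y ∈ Submodule.span ℂ S,
        DifferentiableOn ℂ (fun x => inner ℂ y (f x)) (ball z R) := by
      intro y hy
      induction hy using Submodule.span_induction with
      | mem y hy => exact hS y hy
      | zero => simp
      | add y y' _ _ h h' => simpa only [inner_add_left] using! h.add h'
      | smul c y _ h => simpa only [inner_smul_left] using h.const_mul _
    exact hspan _ (hUsup ▸ le_iSup U s (b i).2)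
  · exact ((U s).norm_starProjection_apply_le (f x)).trans (hC x hx)
  · intro x hx
    have := Submodule.starProjection_tendsto_closure_iSup U hUmono (f x)
    rwa [Submodule.starProjection_eq_self_iff.mpr (by rw [hUsup]; exact hfS x hx)] at this

end Hilbert

/-! ### Sesqui-holomorphic functions as holomorphic functions on U × V*. -/

section ConjProd

variable {E H : Type*} [NormedAddCommGroup E] [NormedSpace ℂ E] [StarAddMonoid E] [StarModule ℂ E]
  [ContinuousStar E] [NormedAddCommGroup H] [InnerProductSpace ℂ H]

/-- The domain `U × V*` of the holomorphic function `(z, v) ↦ f(z, v̄)` attached to a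
sesqui-holomorphic function `f` on `U × V`. -/
def conjProd (U V : Set E) : Set (E × E) := {p | p.1 ∈ U ∧ star p.2 ∈ V}

omit [NormedSpace ℂ E] [StarModule ℂ E] in
lemma isOpen_conjProd {U V : Set E} (hU : IsOpen U) (hV : IsOpen V) : IsOpen (conjProd U V) :=
  (hU.preimage continuous_fst).inter (hV.preimage (continuous_star.comp continuous_snd))

omit [NormedSpace ℂ E] [StarModule ℂ E] [ContinuousStar E] in
lemma conjProd_mono {U V U' V' : Set E} (hU : U ⊆ U') (hV : V ⊆ V') :
    conjProd U V ⊆ conjProd U' V' := fun _ hp => ⟨hU hp.1, hV hp.2⟩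

omit [NormedSpace ℂ E] [StarModule ℂ E] [ContinuousStar E] in
lemma mk_star_mem_conjProd {U V : Set E} {z w : E} (hz : z ∈ U) (hw : w ∈ V) :
    (z, star w) ∈ conjProd U V := ⟨hz, by simpa using hw⟩

omit [NormedSpace ℂ E] [StarModule ℂ E] in
lemma isPreconnected_conjProd {U V : Set E} (hU : IsPreconnected U) (hV : IsPreconnected V) :
    IsPreconnected (conjProd U V) := by
  have : conjProd U V = U ×ˢ (star '' V) := by
    ext p
    simp only [conjProd, mem_ofPred_eq, mem_prod, mem_image]
    refine and_congr_right fun _ => ⟨fun h => ⟨_, h, star_star _⟩, ?_⟩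
    rintro ⟨y, hy, h⟩
    rwa [← h, star_star]
  rw [this]
  exact hU.prod (hV.image _ continuous_star.continuousOn)

lemma differentiableOn_inner_conjProd {φ ψ : E → H} {U V : Set E} (hU : IsOpen U) (hV : IsOpen V)
    (hφ : DifferentiableOn ℂ φ V) (hψ : DifferentiableOn ℂ ψ U) :
    DifferentiableOn ℂ (fun p : E × E => inner ℂ (φ (star p.2)) (ψ p.1)) (conjProd U V) := by
  rintro p ⟨hp1, hp2⟩
  have h1 : DifferentiableAt ℂ (fun v => innerSL ℂ (φ (star v))) p.2 :=
    DifferentiableAt.comp_semilinear₂ (innerSL ℂ : H →L⋆[ℂ] H →L[ℂ] ℂ)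
      (starL ℂ : E ≃L⋆[ℂ] E).toContinuousLinearMap (f := φ)
      (hφ.differentiableAt (hV.mem_nhds hp2))
  have h1' : DifferentiableAt ℂ (fun p : E × E => innerSL ℂ (φ (star p.2))) p :=
    h1.comp p differentiableAt_snd
  have h2 : DifferentiableAt ℂ (fun p : E × E => ψ p.1) p :=
    (hψ.differentiableAt (hU.mem_nhds hp1)).comp p differentiableAt_fst
  exact (h1'.clm_apply h2).differentiableWithinAt

end ConjProd

/-! ### Extension of Hilbert space valued maps on discs through their Gram functions. -/

section OneVariable

variable {H : Type*} [NormedAddCommGroup H] [InnerProductSpace ℂ H] [CompleteSpace H]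

lemma differentiableOn_iteratedDeriv_fst {Q : ℂ × ℂ → ℂ} {W : Set (ℂ × ℂ)} (hW : IsOpen W)
    (hQ : DifferentiableOn ℂ Q W) (n : ℕ) :
    DifferentiableOn ℂ (fun p => iteratedDeriv n (fun ζ => Q (ζ, p.2)) p.1) W := by
  induction n with
  | zero => simpa using hQ
  | succ n ih =>
    refine (differentiableOn_fderiv_apply hW ih (1, 0)).congr fun p hp => ?_
    rw [iteratedDeriv_succ]
    have h1 : HasDerivAt (fun ζ : ℂ => (ζ, p.2)) ((1 : ℂ), (0 : ℂ)) p.1 :=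
      (hasDerivAt_id p.1).prodMk (hasDerivAt_const p.1 p.2)
    exact ((ih.differentiableAt (hW.mem_nhds hp)).hasFDerivAt.comp_hasDerivAt p.1 h1).deriv

lemma iteratedDeriv_inner_right {g : ℂ → H} {δ : ℝ} (hδ : 0 < δ)
    (hg : DifferentiableOn ℂ g (ball 0 δ)) (x : H) (n : ℕ) :
    iteratedDeriv n (fun ζ => inner ℂ x (g ζ)) 0 = inner ℂ x (iteratedDeriv n g 0) := by
  have hc : ContDiffAt ℂ n g 0 :=
    (hg.contDiffOn isOpen_ball).contDiffAt (ball_mem_nhds 0 hδ)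
  have := (innerSL ℂ x).iteratedFDeriv_comp_left hc (i := n) le_rfl
  rw [iteratedDeriv_eq_iteratedFDeriv, iteratedDeriv_eq_iteratedFDeriv]
  exact congrArg (fun m => m fun _ => 1) this

/-- Cauchy's estimates for the Taylor coefficients of a Hilbert space valued function, in terms
of its Gram function. -/
lemma norm_iteratedDeriv_le_of_gram {g : ℂ → H} {δ R : ℝ} (hδ : 0 < δ) (hδR : δ ≤ R)
    (hg : DifferentiableOn ℂ g (ball 0 δ)) {Q : ℂ × ℂ → ℂ}
    (hQ : DifferentiableOn ℂ Q (conjProd (ball 0 R) (ball 0 R)))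
    (hgQ : ∀ ζ ∈ ball (0 : ℂ) δ, ∀ η ∈ ball (0 : ℂ) δ, inner ℂ (g η) (g ζ) = Q (ζ, star η))
    {r : ℝ} (hr : 0 < r) (hrR : r < R) :
    ∃ M : ℝ, 0 ≤ M ∧ ∀ n : ℕ, ‖iteratedDeriv n g 0‖ ≤ n.factorial * M / r ^ n := by
  have hmem : ∀ {ζ v : ℂ}, ‖ζ‖ < R → ‖v‖ < R → (ζ, v) ∈ conjProd (ball (0 : ℂ) R) (ball 0 R) :=
    fun h1 h2 => ⟨by simpa using h1, by simpa using h2⟩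
  have hWo : IsOpen (conjProd (ball (0 : ℂ) R) (ball 0 R)) := isOpen_conjProd isOpen_ball isOpen_ball
  obtain ⟨M, hM⟩ := ((isCompact_closedBall (0 : ℂ) r).prod
    (isCompact_closedBall (0 : ℂ) r)).exists_bound_of_continuousOn (hQ.continuousOn.mono
    (fun p hp => by
      have h1 := mem_closedBall_zero_iff.mp hp.1
      have h2 := mem_closedBall_zero_iff.mp hp.2
      exact hmem (h1.trans_lt hrR) (h2.trans_lt hrR)))
  have hM0 : 0 ≤ M := (norm_nonneg _).trans
    (hM (0, 0) ⟨mem_closedBall_self hr.le, mem_closedBall_self hr.le⟩)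
  refine ⟨√M, Real.sqrt_nonneg _, fun n => ?_⟩
  set V := iteratedDeriv n g 0 with hV
  set T : ℂ × ℂ → ℂ := fun p => iteratedDeriv n (fun ζ => Q (ζ, p.2)) p.1 with hT
  have hTd : DifferentiableOn ℂ T (conjProd (ball 0 R) (ball 0 R)) :=
    differentiableOn_iteratedDeriv_fst hWo hQ n
  -- e continues η ↦ ⟨V, g η⟩ from the small disc to the large one. Cauchy's estimate in ζ bounds e
  -- by n! M / rⁿ on the circle of radius r; a second one in η bounds its n-th derivative at 0,
  -- which is ‖V‖², by (n! / rⁿ)² M. Hence the constant √M.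
  set e : ℂ → ℂ := fun η => star (T (0, star η)) with he
  have hed : DifferentiableOn ℂ e (ball 0 R) := by
    intro η hη
    have hη' : ‖star η‖ < R := by simpa using hη
    have h1 : DifferentiableAt ℂ (fun v : ℂ => T (0, v)) (star η) :=
      (hTd.differentiableAt (hWo.mem_nhds (hmem (by simpa using hδ.trans_le hδR) hη'))).comp
        (star η) ((differentiableAt_const _).prodMk differentiableAt_id)
    have := h1.star_star
    rw [star_star] at this
    exact this.differentiableWithinAt
  have heV : e =ᶠ[𝓝 0] fun η => inner ℂ V (g η) := by
    filter_upwards [ball_mem_nhds (0 : ℂ) hδ] with η hη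
    have : (fun ζ => Q (ζ, star η)) =ᶠ[𝓝 0] fun ζ => inner ℂ (g η) (g ζ) := by
      filter_upwards [ball_mem_nhds (0 : ℂ) hδ] with ζ hζ using (hgQ ζ hζ η hη).symm
    simp only [he, hT]
    rw [this.iteratedDeriv_eq n, iteratedDeriv_inner_right hδ hg]
    exact inner_conj_symm _ _
  have heb : ∀ η ∈ sphere (0 : ℂ) r, ‖e η‖ ≤ n.factorial * M / r ^ n := by
    intro η hη
    have hη' : ‖η‖ = r := by simpa using hη
    simp only [he, norm_star, hT]
    refine Complex.norm_iteratedDeriv_le_of_forall_mem_sphere_norm_le n hr ?_ fun ζ hζ =>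
      hM (ζ, star η) ⟨sphere_subset_closedBall hζ, by simp [hη']⟩
    refine DifferentiableOn.diffContOnCl_ball (U := ball 0 R) ?_ (closedBall_subset_ball hrR)
    exact hQ.comp (by fun_prop) fun ζ hζ => hmem (by simpa using hζ) (by simpa [hη'] using hrR)
  have hfin := Complex.norm_iteratedDeriv_le_of_forall_mem_sphere_norm_le n hr
    (hed.diffContOnCl_ball (closedBall_subset_ball hrR)) heb
  rw [heV.iteratedDeriv_eq n, iteratedDeriv_inner_right hδ hg, ← hV,
    inner_self_eq_norm_sq_to_K] at hfin
  have hsq : ‖V‖ ^ 2 ≤ (n.factorial * √M / r ^ n) ^ 2 := by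
    calc ‖V‖ ^ 2 = ‖((‖V‖ : ℂ) ^ 2)‖ := by simp
      _ ≤ _ := hfin
      _ = (n.factorial * √M / r ^ n) ^ 2 := by
        rw [div_pow, mul_pow, Real.sq_sqrt hM0]; field_simp
  exact (sq_le_sq₀ (norm_nonneg _) (by positivity)).mp hsq

/-- A holomorphic map from a disc into a Hilbert space extends to every larger disc to which its
Gram function extends. -/
theorem exists_extension_disc_of_gram {g : ℂ → H} {δ R : ℝ} (hδ : 0 < δ) (hδR : δ ≤ R)
    (hg : DifferentiableOn ℂ g (ball 0 δ)) {Q : ℂ × ℂ → ℂ}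
    (hQ : DifferentiableOn ℂ Q (conjProd (ball 0 R) (ball 0 R)))
    (hgQ : ∀ ζ ∈ ball (0 : ℂ) δ, ∀ η ∈ ball (0 : ℂ) δ, inner ℂ (g η) (g ζ) = Q (ζ, star η)) :
    ∃ G : ℂ → H, DifferentiableOn ℂ G (ball 0 R) ∧ EqOn G g (ball 0 δ) := by
  refine ⟨fun ζ => ∑' n : ℕ, (n.factorial : ℂ)⁻¹ • ζ ^ n • iteratedDeriv n g 0, ?_, fun ζ hζ => ?_⟩
  · intro ζ₀ hζ₀
    obtain ⟨s, hs1, hs2⟩ := exists_between (mem_ball_zero_iff.mp hζ₀)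
    obtain ⟨r, hr1, hr2⟩ := exists_between hs2
    have hs0 : 0 < s := (norm_nonneg _).trans_lt hs1
    have hr0 : 0 < r := hs0.trans hr1
    obtain ⟨M, hM0, hM⟩ := norm_iteratedDeriv_le_of_gram hδ hδR hg hQ hgQ hr0 hr2
    have hsum : Summable fun n : ℕ => M * (s / r) ^ n :=
      (summable_geometric_of_lt_one (by positivity) ((div_lt_one hr0).mpr hr1)).mul_left _
    have := Complex.differentiableOn_tsum_of_summable_norm (U := ball (0 : ℂ) s) hsum
      (F := fun (n : ℕ) ζ => (n.factorial : ℂ)⁻¹ • ζ ^ n • iteratedDeriv n g 0)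
      (fun n => by fun_prop) isOpen_ball (fun n ζ hζ => by
        have hζ' : ‖ζ‖ ≤ s := (mem_ball_zero_iff.mp hζ).le
        rw [norm_smul, norm_smul, norm_inv, Complex.norm_natCast, norm_pow]
        calc (n.factorial : ℝ)⁻¹ * (‖ζ‖ ^ n * ‖iteratedDeriv n g 0‖)
            ≤ (n.factorial : ℝ)⁻¹ * (s ^ n * (n.factorial * M / r ^ n)) := by
              gcongr; exact hM n
          _ = M * (s / r) ^ n := by
            have : (n.factorial : ℝ) ≠ 0 := by positivity
            rw [div_pow]; field_simp)
    exact (this.differentiableAt (isOpen_ball.mem_nhds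
      (mem_ball_zero_iff.mpr hs1))).differentiableWithinAt
  · simpa using Complex.taylorSeries_eq_on_ball hg hζ

end OneVariable

/-! ### Extension from balls to larger balls along complex lines. -/

section Extension

variable {E H : Type*} [NormedAddCommGroup E] [NormedSpace ℂ E] [StarAddMonoid E] [StarModule ℂ E]
  [ContinuousStar E] [NormedAddCommGroup H] [InnerProductSpace ℂ H] [CompleteSpace H]

omit [ContinuousStar E] in
lemma star_line (p x : E) (ζ : ℂ) : star (line p x ζ) = line (star p) (star x) (star ζ) := by
  simp [line, star_smul]

lemma mem_topologicalClosure_span_of_orthogonal {S : Set H} {y : H}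
    (h : ∀ u : H, (∀ s ∈ S, inner ℂ u s = 0) → inner ℂ u y = 0) :
    y ∈ (Submodule.span ℂ S).topologicalClosure := by
  rw [← Submodule.orthogonal_orthogonal_eq_closure, Submodule.mem_orthogonal]
  refine fun u hu => h u fun s hs => ?_
  rw [← inner_conj_symm, (Submodule.mem_orthogonal _ _).mp hu s (Submodule.subset_span hs), map_zero]

/-- Uniqueness principle: a vector in the closed span of the known values is determined by its
scalar products with them. -/
lemma eq_zero_of_mem_topologicalClosure_span {S : Set H} {y : H}
    (hy : y ∈ (Submodule.span ℂ S).topologicalClosure) (h : ∀ s ∈ S, inner ℂ s y = 0) : y = 0 := by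
  rw [← Submodule.orthogonal_orthogonal_eq_closure] at hy
  have hy' : y ∈ (Submodule.span ℂ S)ᗮ := by
    rw [Submodule.mem_orthogonal]
    intro u hu
    induction hu using Submodule.span_induction with
    | mem u hu => exact h u hu
    | zero => simp
    | add u v _ _ hu hv => rw [inner_add_left, hu, hv, add_zero]
    | smul c u _ hu => rw [inner_smul_left, hu, mul_zero]
  exact inner_self_eq_zero.mp ((Submodule.mem_orthogonal _ _).mp hy y hy')

omit [ContinuousStar E] in
/-- The value at `z` of the continuation of `φ` along the complex line through `p` and `z`. -/
lemma exists_continuation_of_gram {φ : E → H} {p : E} {ε r : ℝ} (hε : 0 < ε)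
    (hφ : DifferentiableOn ℂ φ (ball p ε)) {J : E × E → ℂ}
    (hJ : DifferentiableOn ℂ J (conjProd (ball p r) (ball p r)))
    (hφJ : ∀ z ∈ ball p ε, ∀ w ∈ ball p ε, inner ℂ (φ w) (φ z) = J (z, star w))
    (hεr : ε ≤ r) {z : E} (hz : z ∈ ball p r) :
    ∃ y : H, y ∈ (Submodule.span ℂ (φ '' ball p ε)).topologicalClosure ∧
      (∀ w ∈ ball p ε, inner ℂ (φ w) y = J (z, star w)) ∧ inner ℂ y y = J (z, star z) := by
  have hr : 0 < r := hε.trans_le hεr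
  set x := z - p with hx
  have hxr : ‖x‖ < r := by simpa [hx, dist_eq_norm] using hz
  have hx0 := norm_nonneg x
  -- On the disc of radius δ the line stays where φ is given; the radius R below exceeds 1 so that ζ
  -- = 1, whose image is z, is reached within `ball p r`.
  obtain ⟨δ, hδ0, hδ1, hδx⟩ : ∃ δ : ℝ, 0 < δ ∧ δ ≤ 1 ∧ δ * ‖x‖ < ε := by
    refine ⟨ε / (‖x‖ + ε), by positivity, ?_, ?_⟩
    · rw [div_le_one (by positivity)]; linarith
    · rw [div_mul_eq_mul_div, div_lt_iff₀ (by positivity)]; nlinarith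
  obtain ⟨R, hR1, hRx⟩ : ∃ R : ℝ, 1 < R ∧ R * ‖x‖ < r := by
    refine ⟨2 * r / (‖x‖ + r), ?_, ?_⟩
    · rw [lt_div_iff₀ (by positivity)]; linarith
    · rw [div_mul_eq_mul_div, div_lt_iff₀ (by positivity)]; nlinarith
  have hR0 : 0 < R := by linarith
  have hlδ : ∀ ζ ∈ ball (0 : ℂ) δ, line p x ζ ∈ ball p ε := fun ζ hζ =>
    line_mem_ball hδx (mem_ball_zero_iff.mp hζ).le
  have hlR : ∀ ζ ∈ ball (0 : ℂ) R, line p x ζ ∈ ball p r := fun ζ hζ =>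
    line_mem_ball hRx (mem_ball_zero_iff.mp hζ).le
  have h1R : (1 : ℂ) ∈ ball (0 : ℂ) R := by simpa using hR1
  have hl1 : line p x 1 = z := by simp [line, hx]
  set Q : ℂ × ℂ → ℂ := fun q => J (line p x q.1, line (star p) (star x) q.2) with hQdef
  have hQ : DifferentiableOn ℂ Q (conjProd (ball 0 R) (ball 0 R)) := by
    refine hJ.comp (f := fun q : ℂ × ℂ => (line p x q.1, line (star p) (star x) q.2))
      (Differentiable.differentiableOn (by fun_prop)) ?_
    rintro q ⟨h1, h2⟩
    refine ⟨hlR _ h1, ?_⟩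
    rw [star_line, star_star, star_star]
    exact hlR _ h2
  have hQs : ∀ ζ η : ℂ, Q (ζ, star η) = J (line p x ζ, star (line p x η)) := fun ζ η => by
    rw [star_line]
  obtain ⟨G, hGd, hGe⟩ := exists_extension_disc_of_gram hδ0 (hδ1.trans hR1.le)
    (g := fun ζ => φ (line p x ζ)) (hφ.comp (by fun_prop) hlδ) hQ
    (fun ζ hζ η hη => by rw [hQs, hφJ _ (hlδ ζ hζ) _ (hlδ η hη)])
  have hGe0 : ∀ᶠ ζ in 𝓝 (0 : ℂ), ζ ∈ ball (0 : ℂ) δ := ball_mem_nhds 0 hδ0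
  have hBR : IsPreconnected (ball (0 : ℂ) R) := (convex_ball 0 R).isPreconnected
  refine ⟨G 1, mem_topologicalClosure_span_of_orthogonal fun u hu => ?_, fun w hw => ?_, ?_⟩
  · refine eq_zero_of_eventuallyEq_zero isOpen_ball hBR (f := fun ζ => inner ℂ u (G ζ))
      ((innerSL ℂ u).differentiable.comp_differentiableOn hGd) (mem_ball_self hR0) ?_ 1 h1R
    filter_upwards [hGe0] with ζ hζ
    rw [hGe hζ]
    exact hu _ ⟨_, hlδ ζ hζ, rfl⟩
  · refine sub_eq_zero.mp ?_
    rw [← hl1]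
    refine eq_zero_of_eventuallyEq_zero isOpen_ball hBR
      (f := fun ζ => inner ℂ (φ w) (G ζ) - J (line p x ζ, star w)) (DifferentiableOn.sub
      ((innerSL ℂ (φ w)).differentiable.comp_differentiableOn hGd) ?_) (mem_ball_self hR0) ?_ 1 h1R
    · exact hJ.comp (f := fun ζ => (line p x ζ, star w)) (by fun_prop) fun ζ hζ =>
        mk_star_mem_conjProd (hlR ζ hζ) (ball_subset_ball hεr hw)
    · filter_upwards [hGe0] with ζ hζ
      rw [hGe hζ, hφJ _ (hlδ ζ hζ) w hw, sub_self]
  · refine sub_eq_zero.mp ?_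
    have := eq_zero_of_eventuallyEq_zero (isOpen_conjProd isOpen_ball isOpen_ball)
      (isPreconnected_conjProd hBR hBR) (p := ((0 : ℂ), (0 : ℂ)))
      (f := fun q => inner ℂ (G (star q.2)) (G q.1) - Q q)
      ((differentiableOn_inner_conjProd isOpen_ball isOpen_ball hGd hGd).sub hQ)
      ⟨mem_ball_self hR0, by simpa using hR0⟩ ?_ (1, star 1) (mk_star_mem_conjProd h1R h1R)
    · simpa only [star_star, hQs, hl1] using this
    · filter_upwards [(isOpen_conjProd isOpen_ball isOpen_ball).mem_nhds
        (show ((0 : ℂ), (0 : ℂ)) ∈ conjProd (ball 0 δ) (ball 0 δ) from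
          ⟨mem_ball_self hδ0, by simpa using hδ0⟩)] with q hq
      have hq2 := hQs q.1 (star q.2)
      rw [star_star] at hq2
      rw [hGe hq.1, hGe hq.2, hφJ _ (hlδ _ hq.1) _ (hlδ _ hq.2), ← hq2, sub_self]

/-- A holomorphic map from a ball into a Hilbert space extends to every larger ball to which its
Gram function extends sesqui-holomorphically. -/
theorem exists_extension_ball_of_gram {φ : E → H} {p : E} {ε r : ℝ} (hε : 0 < ε) (hεr : ε ≤ r)
    (hφ : DifferentiableOn ℂ φ (ball p ε)) {J : E × E → ℂ}
    (hJ : DifferentiableOn ℂ J (conjProd (ball p r) (ball p r)))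
    (hφJ : ∀ z ∈ ball p ε, ∀ w ∈ ball p ε, inner ℂ (φ w) (φ z) = J (z, star w)) :
    ∃ ψ : E → H, DifferentiableOn ℂ ψ (ball p r) ∧ EqOn ψ φ (ball p ε) := by
  -- ψ is built point by point along separate lines, so its joint holomorphy needs proof. It is
  -- weakly holomorphic against the φ(w), as ⟨φ(w), ψ(x)⟩ = J(x, w̄), and locally bounded, as
  -- ‖ψ(x)‖² = J(x, x̄).
  choose! ψ hψ1 hψ2 hψ3 using fun z (hz : z ∈ ball p r) =>
    exists_continuation_of_gram hε hφ hJ hφJ hεr hz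
  refine ⟨ψ, fun z hz => ?_, fun z hz => ?_⟩
  · have hJz : ContinuousAt (fun x => J (x, star x)) z := by
      have h1 : ContinuousAt J (z, star z) := (hJ.differentiableAt
        ((isOpen_conjProd isOpen_ball isOpen_ball).mem_nhds
          (mk_star_mem_conjProd hz hz))).continuousAt
      exact ContinuousAt.comp (f := fun x : E => (x, star x)) (g := J) h1
        (continuous_id.prodMk continuous_star).continuousAt
    have hev : ∀ᶠ x in 𝓝 z, ‖J (x, star x)‖ < ‖J (z, star z)‖ + 1 :=
      hJz.norm.eventually (gt_mem_nhds (by linarith))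
    obtain ⟨s, hs, hsub⟩ := Metric.mem_nhds_iff.mp (inter_mem (isOpen_ball.mem_nhds hz) hev)
    refine (differentiableAt_of_weak (S := φ '' ball p ε) hs (C := √(‖J (z, star z)‖ + 1))
      (fun x hx => ?_) ?_ fun x hx => hψ1 x (hsub hx).1).differentiableWithinAt
    · refine Real.le_sqrt_of_sq_le ?_
      have h3 := congrArg norm (hψ3 x (hsub hx).1)
      rw [inner_self_eq_norm_sq_to_K] at h3
      have h4 : ‖ψ x‖ ^ 2 = ‖J (x, star x)‖ := by rw [← h3]; simp
      rw [h4]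
      exact (hsub hx).2.le
    · rintro _ ⟨w, hw, rfl⟩
      refine DifferentiableOn.congr (f := fun x => J (x, star w)) ?_ fun x hx =>
        hψ2 x (hsub hx).1 w hw
      exact hJ.comp (f := fun x => (x, star w)) (by fun_prop) fun x hx =>
        mk_star_mem_conjProd (hsub hx).1 (ball_subset_ball hεr hw)
  · have hzr := ball_subset_ball hεr hz
    refine sub_eq_zero.mp (eq_zero_of_mem_topologicalClosure_span (S := φ '' ball p ε)
      (Submodule.sub_mem _ (hψ1 z hzr) (Submodule.le_topologicalClosure _
        (Submodule.subset_span ⟨z, hz, rfl⟩))) ?_)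
    rintro _ ⟨w, hw, rfl⟩
    rw [inner_sub_right, hψ2 z hzr w hw, hφJ z hz w hw, sub_self]

end Extension

/-! ### Continuation of a family of vectors over the whole domain. -/

section Continuation

variable {E H : Type*} [NormedAddCommGroup E] [NormedSpace ℂ E] [StarAddMonoid E] [StarModule ℂ E]
  [ContinuousStar E] [NormedAddCommGroup H] [InnerProductSpace ℂ H]
  {ι : Type*} {Ω : Set E} {D : E × E → ℂ} {N : ι → ι → E × E → ℂ}

/-- Permanence of the relation `D(z, w) ⟨ψ(w), φ(z)⟩ = N(z, w)` under continuation. -/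
lemma gram_relation_of_eventually {N : E × E → ℂ}
    (hD : DifferentiableOn ℂ D (conjProd Ω Ω)) (hN : DifferentiableOn ℂ N (conjProd Ω Ω))
    {U V : Set E} (hU : IsOpen U) (hV : IsOpen V) (hUc : IsPreconnected U) (hVc : IsPreconnected V)
    (hUΩ : U ⊆ Ω) (hVΩ : V ⊆ Ω) {φ ψ : E → H} (hφ : DifferentiableOn ℂ φ U)
    (hψ : DifferentiableOn ℂ ψ V) {p q : E} (hp : p ∈ U) (hq : q ∈ V)
    (h : ∀ᶠ x in 𝓝 (p, star q), D x * inner ℂ (ψ (star x.2)) (φ x.1) = N x)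
    {z w : E} (hz : z ∈ U) (hw : w ∈ V) :
    D (z, star w) * inner ℂ (ψ w) (φ z) = N (z, star w) := by
  have hsub := conjProd_mono hUΩ hVΩ
  have := eq_zero_of_eventuallyEq_zero (isOpen_conjProd hU hV) (isPreconnected_conjProd hUc hVc)
    (f := fun x => D x * inner ℂ (ψ (star x.2)) (φ x.1) - N x)
    (((hD.mono hsub).mul (differentiableOn_inner_conjProd hU hV hψ hφ)).sub (hN.mono hsub))
    (mk_star_mem_conjProd hp hq) (h.mono fun x hx => sub_eq_zero.mpr hx) _
    (mk_star_mem_conjProd hz hw)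
  simpa only [star_star, sub_eq_zero] using this

/-- Two holomorphic families with the Gram relation `D(z, w) ⟨φ_l(w), φ_k(z)⟩ = N_kl(z, w)` which
agree near one point agree on the whole intersection of their domains. -/
lemma eqOn_inter_of_gram_relation (hΩ : IsOpen Ω)
    (hD : DifferentiableOn ℂ D (conjProd Ω Ω)) (hN : ∀ k l, DifferentiableOn ℂ (N k l) (conjProd Ω Ω))
    (hD0 : ∀ w ∈ Ω, D (w, star w) ≠ 0)
    {U V : Set E} (hU : IsOpen U) (hV : IsOpen V) (hUc : IsPreconnected U) (hVc : IsPreconnected V)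
    (hUΩ : U ⊆ Ω) (hVΩ : V ⊆ Ω) {Φ Ψ : ι → E → H} (hΦ : ∀ k, DifferentiableOn ℂ (Φ k) U)
    (hΨ : ∀ k, DifferentiableOn ℂ (Ψ k) V)
    (hrel : ∀ k l, ∀ z ∈ U, ∀ w ∈ U, D (z, star w) * inner ℂ (Φ l w) (Φ k z) = N k l (z, star w))
    {p : E} (hpU : p ∈ U) (hpV : p ∈ V) (heq : ∀ k, ∀ᶠ x in 𝓝 p, Ψ k x = Φ k x)
    (k : ι) {z : E} (hzU : z ∈ U) (hzV : z ∈ V) : Ψ k z = Φ k z := by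
  have hrel2 : ∀ l, ∀ w ∈ U, D (z, star w) * inner ℂ (Φ l w) (Ψ k z) = N k l (z, star w) := by
    intro l w hw
    refine gram_relation_of_eventually hD (hN k l) hV hU hVc hUc hVΩ hUΩ (hΨ k) (hΦ l) hpV hpU ?_
      hzV hw
    have h1 : ∀ᶠ x in 𝓝 (p, star p), Ψ k x.1 = Φ k x.1 :=
      (continuous_fst.tendsto (p, star p)).eventually (heq k)
    filter_upwards [h1, (isOpen_conjProd hU hU).mem_nhds (mk_star_mem_conjProd hpU hpU)]
      with x hx hxU
    have := hrel k l x.1 hxU.1 (star x.2) hxU.2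
    rw [star_star] at this
    rw [hx]
    exact this
  -- x is orthogonal to Φ l w for w near z, where D(z, w̄) ≠ 0, hence for all w in U; by agreement
  -- near p it is orthogonal to Ψ l near p, hence on V. Being a difference of such vectors, x is
  -- orthogonal to itself. The intersection of U and V need not be connected, so no monodromy
  -- arises.
  set x := Ψ k z - Φ k z with hx
  have hDz : ∀ᶠ w in 𝓝 z, D (z, star w) ≠ 0 := by
    have hc : ContinuousAt (fun w => D (z, star w)) z := by
      have h1 : ContinuousAt D (z, star z) := (hD.differentiableAt
        ((isOpen_conjProd hΩ hΩ).mem_nhds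
          (mk_star_mem_conjProd (hUΩ hzU) (hUΩ hzU)))).continuousAt
      exact ContinuousAt.comp (f := fun w : E => (z, star w)) (g := D) h1
        (continuous_const.prodMk continuous_star).continuousAt
    exact hc.eventually_ne (hD0 z (hUΩ hzU))
  have h1 : ∀ l, ∀ w ∈ U, inner ℂ x (Φ l w) = 0 := by
    intro l
    refine eq_zero_of_eventuallyEq_zero hU hUc
      ((innerSL ℂ x).differentiable.comp_differentiableOn (hΦ l)) hzU ?_
    filter_upwards [hDz, hU.mem_nhds hzU] with w hw hwU
    have : D (z, star w) * inner ℂ (Φ l w) x = 0 := by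
      rw [hx, inner_sub_right, mul_sub, hrel2 l w hwU, hrel k l z hzU w hwU, sub_self]
    have h0 := (mul_eq_zero.mp this).resolve_left hw
    change inner ℂ x (Φ l w) = 0
    rw [← inner_conj_symm, h0, map_zero]
  have h2 : ∀ l, ∀ w ∈ V, inner ℂ x (Ψ l w) = 0 := by
    intro l
    refine eq_zero_of_eventuallyEq_zero hV hVc
      ((innerSL ℂ x).differentiable.comp_differentiableOn (hΨ l)) hpV ?_
    filter_upwards [heq l, hU.mem_nhds hpU] with w hw hwU
    simpa [hw] using h1 l w hwU
  have : inner ℂ x x = 0 := by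
    conv_lhs => rw [hx, inner_sub_right, ← hx]
    rw [h1 k z hzU, h2 k z hzV, sub_zero]
  exact sub_eq_zero.mp (inner_self_eq_zero.mp this)

/-- `Φ` is a holomorphic continuation of the family `φ` from `Ω₀` to the connected open subset `U`
of `Ω`. -/
structure IsContinuation (Ω Ω₀ : Set E) (φ : ι → E → H) (U : Set E) (Φ : ι → E → H) : Prop where
  isOpen : IsOpen U
  isPreconnected : IsPreconnected U
  subset : U ⊆ Ω
  superset : Ω₀ ⊆ U
  differentiableOn : ∀ k, DifferentiableOn ℂ (Φ k) U
  eqOn : ∀ k, EqOn (Φ k) (φ k) Ω₀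

/-- Any two continuations restrict to φ on Ω₀ and have connected domains, so the relation spreads by
the identity theorem. Allowing different domains for the two variables is what later relates vectors
chosen from unrelated continuations. -/
lemma IsContinuation.gram_relation
    (hD : DifferentiableOn ℂ D (conjProd Ω Ω)) (hN : ∀ k l, DifferentiableOn ℂ (N k l) (conjProd Ω Ω))
    {Ω₀ : Set E} (hΩ₀ : IsOpen Ω₀) (hne : Ω₀.Nonempty) {φ : ι → E → H}
    (hrel : ∀ k l, ∀ z ∈ Ω₀, ∀ w ∈ Ω₀, D (z, star w) * inner ℂ (φ l w) (φ k z) = N k l (z, star w))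
    {U V : Set E} {Φ Ψ : ι → E → H} (hΦ : IsContinuation Ω Ω₀ φ U Φ)
    (hΨ : IsContinuation Ω Ω₀ φ V Ψ) (k l : ι) {z w : E} (hz : z ∈ U) (hw : w ∈ V) :
    D (z, star w) * inner ℂ (Ψ l w) (Φ k z) = N k l (z, star w) := by
  obtain ⟨p, hp⟩ := hne
  refine gram_relation_of_eventually hD (hN k l) hΦ.isOpen hΨ.isOpen hΦ.isPreconnected
    hΨ.isPreconnected hΦ.subset hΨ.subset (hΦ.differentiableOn k) (hΨ.differentiableOn l)
    (hΦ.superset hp) (hΨ.superset hp) ?_ hz hw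
  filter_upwards [(isOpen_conjProd hΩ₀ hΩ₀).mem_nhds (mk_star_mem_conjProd hp hp)] with x hx
  have := hrel k l x.1 hx.1 (star x.2) hx.2
  rw [star_star] at this
  rw [hΦ.eqOn k hx.1, hΨ.eqOn l hx.2]
  exact this

variable [CompleteSpace H]

/-- A continuation can be extended across every boundary point lying in `Ω`. -/
lemma IsContinuation.exists_extension (hΩ : IsOpen Ω)
    (hD : DifferentiableOn ℂ D (conjProd Ω Ω)) (hN : ∀ k l, DifferentiableOn ℂ (N k l) (conjProd Ω Ω))
    (hD0 : ∀ w ∈ Ω, D (w, star w) ≠ 0)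
    {Ω₀ : Set E} (hΩ₀ : IsOpen Ω₀) (hne : Ω₀.Nonempty) {φ : ι → E → H}
    (hrel : ∀ k l, ∀ z ∈ Ω₀, ∀ w ∈ Ω₀, D (z, star w) * inner ℂ (φ l w) (φ k z) = N k l (z, star w))
    {q : E} (hq : q ∈ Ω) :
    ∃ r > 0, ∀ p ∈ ball q r, ∀ (U : Set E) (Φ : ι → E → H), p ∈ U → IsContinuation Ω Ω₀ φ U Φ →
      ∃ (V : Set E) (Ψ : ι → E → H), q ∈ V ∧ IsContinuation Ω Ω₀ φ V Ψ := by
  classical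
  have hWo := isOpen_conjProd hΩ hΩ
  have hDq : ∀ᶠ x in 𝓝 (q, star q), D x ≠ 0 ∧ x ∈ conjProd Ω Ω :=
    ((hD.differentiableAt (hWo.mem_nhds (mk_star_mem_conjProd hq hq))).continuousAt.eventually_ne
      (hD0 q hq)).and (hWo.mem_nhds (mk_star_mem_conjProd hq hq))
  have hcont : Tendsto (fun x : E × E => (x.1, star x.2)) (𝓝 (q, q)) (𝓝 (q, star q)) :=
    (by fun_prop : Continuous fun x : E × E => (x.1, star x.2)).tendsto (q, q)
  obtain ⟨R, hR, hRs⟩ := Metric.mem_nhds_iff.mp (hcont.eventually hDq)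
  have hball : ∀ z ∈ ball q R, ∀ w ∈ ball q R, D (z, star w) ≠ 0 ∧ z ∈ Ω := by
    intro z hz w hw
    have := hRs (show (z, w) ∈ ball (q, q) R by rw [← ball_prod_same]; exact ⟨hz, hw⟩)
    exact ⟨this.1, this.2.1⟩
  -- With p within R / 2 of q, the ball of radius R / 2 about p contains q and stays in the ball
  -- where D has no zeros. The radius depends on neither p nor U, which makes the set of reachable
  -- points relatively closed.
  refine ⟨R / 2, by positivity, fun p hp U Φ hpU hΦ => ?_⟩
  have hpR : ball p (R / 2) ⊆ ball q R := ball_subset_ball' (by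
    have := (mem_ball.mp hp).le; linarith)
  have hPΩ : ball p (R / 2) ⊆ Ω := fun z hz => (hball z (hpR hz) z (hpR hz)).2
  obtain ⟨ε, hε, hεU⟩ : ∃ ε, (0 < ε ∧ ε ≤ R / 2) ∧ ball p ε ⊆ U := by
    obtain ⟨ε, hε, h⟩ := Metric.isOpen_iff.mp hΦ.isOpen p hpU
    exact ⟨min ε (R / 2), ⟨lt_min hε (by positivity), min_le_right _ _⟩,
      (ball_subset_ball (min_le_left _ _)).trans h⟩
  have hrelU : ∀ k l, ∀ z ∈ U, ∀ w ∈ U,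
      D (z, star w) * inner ℂ (Φ l w) (Φ k z) = N k l (z, star w) := fun k l z hz w hw =>
    hΦ.gram_relation hD hN hΩ₀ hne hrel hΦ k l hz hw
  -- Each component is extended separately, using only its own Gram function N k k / D.
  have hext : ∀ k, ∃ ψ : E → H, DifferentiableOn ℂ ψ (ball p (R / 2)) ∧
      EqOn ψ (Φ k) (ball p ε) := by
    intro k
    have hsub := conjProd_mono hPΩ hPΩ
    refine exists_extension_ball_of_gram hε.1 hε.2 ((hΦ.differentiableOn k).mono hεU)
      (J := fun x => N k k x * (D x)⁻¹) (((hN k k).mono hsub).fun_mul ((hD.mono hsub).fun_inv fun x hx => ?_)) ?_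
    · have := (hball x.1 (hpR hx.1) (star x.2) (hpR hx.2)).1
      rwa [star_star] at this
    · intro z hz w hw
      have hzw := (hball z (hpR (ball_subset_ball hε.2 hz)) w
        (hpR (ball_subset_ball hε.2 hw))).1
      rw [← div_eq_mul_inv, eq_div_iff hzw, mul_comm]
      exact hrelU k k z (hεU hz) w (hεU hw)
  choose ψ hψd hψe using hext
  have hagree : ∀ k, ∀ z ∈ U, z ∈ ball p (R / 2) → ψ k z = Φ k z := fun k z hzU hzP =>
    eqOn_inter_of_gram_relation hΩ hD hN hD0 hΦ.isOpen isOpen_ball hΦ.isPreconnected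
      isPreconnected_ball hΦ.subset hPΩ hΦ.differentiableOn hψd hrelU hpU
      (mem_ball_self (by positivity))
      (fun k => (hψe k).eventuallyEq_of_mem (ball_mem_nhds p hε.1)) k hzU hzP
  set Ψ : ι → E → H := fun k z => if z ∈ U then Φ k z else ψ k z with hΨ
  have hΨU : ∀ k, EqOn (Ψ k) (Φ k) U := fun k z hz => by simp [hΨ, hz]
  have hΨP : ∀ k, EqOn (Ψ k) (ψ k) (ball p (R / 2)) := fun k z hz => by
    by_cases hzU : z ∈ U
    · rw [hΨU k hzU, hagree k z hzU hz]
    · simp [hΨ, hzU]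
  refine ⟨U ∪ ball p (R / 2), Ψ, Or.inr (mem_ball_comm.mp hp), hΦ.isOpen.union isOpen_ball,
    hΦ.isPreconnected.union p hpU (mem_ball_self (by positivity)) isPreconnected_ball,
    union_subset hΦ.subset hPΩ, hΦ.superset.trans subset_union_left, fun k => ?_, fun k z hz => ?_⟩
  · rintro z (hz | hz)
    · exact (((hΦ.differentiableOn k).differentiableAt (hΦ.isOpen.mem_nhds hz)).congr_of_eventuallyEq
        ((hΨU k).eventuallyEq_of_mem (hΦ.isOpen.mem_nhds hz))).differentiableWithinAt
    · exact (((hψd k).differentiableAt (isOpen_ball.mem_nhds hz)).congr_of_eventuallyEq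
        ((hΨP k).eventuallyEq_of_mem (isOpen_ball.mem_nhds hz))).differentiableWithinAt
  · rw [hΨU k (hΦ.superset hz), hΦ.eqOn k hz]

/-- A holomorphic family of vectors on `Ω₀` whose Gram matrices are quotients of functions that are
sesqui-holomorphic on the connected open set `Ω ⊇ Ω₀` extends to `Ω`, if the denominator does not
vanish on the diagonal. -/
theorem exists_continuation_of_gram_relation (hΩ : IsOpen Ω) (hΩc : IsPreconnected Ω)
    (hD : DifferentiableOn ℂ D (conjProd Ω Ω)) (hN : ∀ k l, DifferentiableOn ℂ (N k l) (conjProd Ω Ω))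
    (hD0 : ∀ w ∈ Ω, D (w, star w) ≠ 0)
    {Ω₀ : Set E} (hΩ₀ : IsOpen Ω₀) (hne : Ω₀.Nonempty) (hΩ₀c : IsPreconnected Ω₀) (hsub : Ω₀ ⊆ Ω)
    {φ : ι → E → H} (hφ : ∀ k, DifferentiableOn ℂ (φ k) Ω₀)
    (hrel : ∀ k l, ∀ z ∈ Ω₀, ∀ w ∈ Ω₀,
      D (z, star w) * inner ℂ (φ l w) (φ k z) = N k l (z, star w)) :
    ∃ Φ : ι → E → H, (∀ k, DifferentiableOn ℂ (Φ k) Ω) ∧ ∀ k l, ∀ z ∈ Ω, ∀ w ∈ Ω,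
      D (z, star w) * inner ℂ (Φ l w) (Φ k z) = N k l (z, star w) := by
  set V : Set E := {q | ∃ (U : Set E) (Φ : ι → E → H), q ∈ U ∧ IsContinuation Ω Ω₀ φ U Φ} with hV
  have hVo : IsOpen V := isOpen_iff_mem_nhds.mpr fun q ⟨U, Φ, hqU, hΦ⟩ =>
    mem_of_superset (hΦ.isOpen.mem_nhds hqU) fun x hx => ⟨U, Φ, hx, hΦ⟩
  have hΩV : Ω ⊆ V := by
    refine hΩc.subset_of_closure_inter_subset hVo ?_ ?_
    · obtain ⟨p, hp⟩ := hne
      exact ⟨p, hsub hp, Ω₀, φ, hp, hΩ₀, hΩ₀c, hsub, Subset.rfl, hφ, fun k => eqOn_refl _ _⟩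
    · rintro q ⟨hqV, hq⟩
      obtain ⟨r, hr, h⟩ := IsContinuation.exists_extension hΩ hD hN hD0 hΩ₀ hne hrel hq
      obtain ⟨p, ⟨U, Φ, hpU, hΦ⟩, hpq⟩ := Metric.mem_closure_iff.mp hqV r hr
      exact h p (mem_ball_comm.mp (mem_ball.mpr hpq)) U Φ hpU hΦ
  choose! U Φ hU hΦ using fun q (hq : q ∈ Ω) => hΩV hq
  refine ⟨fun k z => Φ z k z, fun k q hq => ?_, fun k l z hz w hw =>
    (hΦ z hz).gram_relation hD hN hΩ₀ hne hrel (hΦ w hw) k l (hU z hz) (hU w hw)⟩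
  -- The continuation was chosen independently at each point; near q all choices agree with the one
  -- at q, since they share the germ on Ω₀.
  have heq : (fun z => Φ z k z) =ᶠ[𝓝 q] Φ q k := by
    filter_upwards [(hΦ q hq).isOpen.mem_nhds (hU q hq), hΩ.mem_nhds hq] with z hzU hz
    obtain ⟨p, hp⟩ := hne
    refine eqOn_inter_of_gram_relation hΩ hD hN hD0 (hΦ q hq).isOpen (hΦ z hz).isOpen
      (hΦ q hq).isPreconnected (hΦ z hz).isPreconnected (hΦ q hq).subset (hΦ z hz).subset
      (hΦ q hq).differentiableOn (hΦ z hz).differentiableOn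
      (fun k l z hz w hw => (hΦ q hq).gram_relation hD hN hΩ₀ ⟨p, hp⟩ hrel (hΦ q hq) k l hz hw)
      ((hΦ q hq).superset hp) ((hΦ z hz).superset hp) (fun k => ?_) k hzU (hU z hz)
    filter_upwards [hΩ₀.mem_nhds hp] with x hx
    rw [(hΦ z hz).eqOn k hx, (hΦ q hq).eqOn k hx]
  exact ((((hΦ q hq).differentiableOn k).differentiableAt
    ((hΦ q hq).isOpen.mem_nhds (hU q hq))).congr_of_eventuallyEq heq).differentiableWithinAt

end Continuation

/-! ### Uniqueness of polarization. -/

section Polarization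

variable {E : Type*} [NormedAddCommGroup E] [NormedSpace ℂ E] [StarAddMonoid E] [StarModule ℂ E]

/-- A sesqui-holomorphic function on a convex open set is determined by its values on the
diagonal. -/
theorem eq_zero_of_diag_eq_zero {f : E × E → ℂ} {B : Set E} (hB : IsOpen B) (hBc : Convex ℝ B)
    (hf : DifferentiableOn ℂ f (conjProd B B)) (h0 : ∀ w ∈ B, f (w, star w) = 0)
    {z w : E} (hz : z ∈ B) (hw : w ∈ B) : f (z, star w) = 0 := by
  -- The line a + ζb passes through z at ζ = i and through w at ζ = -i, while real ζ give points (x,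
  -- x̄) of the diagonal. So f restricted to ζ ↦ (a + ζb, ā + ζb̄) vanishes at real ζ near 0, hence
  -- at ζ = i.
  set a : E := (2⁻¹ : ℂ) • (z + w) with ha
  set b : E := (-(Complex.I / 2)) • (z - w) with hb
  have hIz : line a b Complex.I = z := by
    simp only [line, ha, hb, smul_smul]
    have : Complex.I * -(Complex.I / 2) = 2⁻¹ := by
      linear_combination (-1 / 2 : ℂ) * Complex.I_mul_I
    rw [this, ← smul_add]
    have : z + w + (z - w) = (2 : ℂ) • z := by rw [two_smul]; abel
    rw [this, smul_smul]; norm_num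
  have hIw : line a b (star Complex.I) = w := by
    simp only [line, ha, hb, smul_smul]
    have : star Complex.I * -(Complex.I / 2) = -2⁻¹ := by
      rw [Complex.star_def, Complex.conj_I]
      linear_combination (1 / 2 : ℂ) * Complex.I_mul_I
    rw [this, neg_smul, ← sub_eq_add_neg, ← smul_sub]
    have : z + w - (z - w) = (2 : ℂ) • w := by rw [two_smul]; abel
    rw [this, smul_smul]; norm_num
  set S : Set ℂ := line a b ⁻¹' B ∩ (fun ζ => line a b (star ζ)) ⁻¹' B with hS
  have hSo : IsOpen S := (hB.preimage (continuous_line a b)).inter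
    (hB.preimage ((continuous_line a b).comp continuous_star))
  have hSc : Convex ℝ S := by
    refine (convex_preimage_line a b hBc).inter ?_
    exact (convex_preimage_line a b hBc).linear_preimage
      (Complex.conjAe.toLinearMap : ℂ →ₗ[ℝ] ℂ)
  have hIS : Complex.I ∈ S := ⟨by simpa [hIz] using hz, by
    change line a b (star Complex.I) ∈ B
    rwa [hIw]⟩
  have h0S : (0 : ℂ) ∈ S := by
    have haB : a ∈ B := by
      have := hBc hz hw (a := 2⁻¹) (b := 2⁻¹) (by norm_num) (by norm_num) (by norm_num)
      rw [← smul_add] at this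
      rw [ha]
      convert this using 1
      rw [← Complex.coe_smul]; norm_num
    exact ⟨by simpa using haB, by simpa using haB⟩
  set h : ℂ → ℂ := fun ζ => f (line a b ζ, line (star a) (star b) ζ) with hh
  have hd : DifferentiableOn ℂ h S := by
    refine hf.comp (f := fun ζ => (line a b ζ, line (star a) (star b) ζ))
      (Differentiable.differentiableOn (by fun_prop)) fun ζ hζ => ⟨hζ.1, ?_⟩
    rw [star_line, star_star, star_star]
    exact hζ.2
  have hreal : Tendsto (fun t : ℝ => (t : ℂ)) (𝓝[≠] 0) (𝓝[≠] 0) := by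
    refine tendsto_nhdsWithin_iff.mpr ⟨?_, ?_⟩
    · have : Tendsto (fun t : ℝ => (t : ℂ)) (𝓝 0) (𝓝 ((0 : ℝ) : ℂ)) :=
        Complex.continuous_ofReal.tendsto 0
      simpa using this.mono_left nhdsWithin_le_nhds
    · filter_upwards [self_mem_nhdsWithin] with t ht
      simpa using ht
  have hfreq : ∃ᶠ ζ in 𝓝[≠] (0 : ℂ), h ζ = 0 := by
    refine hreal.frequently (Eventually.frequently ?_)
    have hS0 : ∀ᶠ t : ℝ in 𝓝[≠] 0, (t : ℂ) ∈ S :=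
      hreal.eventually (nhdsWithin_le_nhds (hSo.mem_nhds h0S))
    filter_upwards [hS0] with t ht
    have hst : line (star a) (star b) (t : ℂ) = star (line a b t) := by
      rw [star_line, Complex.star_def, Complex.conj_ofReal]
    rw [hh]
    simp only [hst]
    exact h0 _ ht.1
  have := (hd.analyticOnNhd hSo).eqOn_zero_of_preconnected_of_frequently_eq_zero
    hSc.isPreconnected h0S hfreq hIS
  have hfin : line (star a) (star b) Complex.I = star w := by
    rw [← hIw, star_line, star_star]
  simpa [hh, hIz, hfin] using this

end Polarization

/-! ### Mixed derivatives of a logarithm as quotients of globally defined functions. -/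

section LogarithmicHessian

variable {X : Type*} [NormedAddCommGroup X] [NormedSpace ℂ X]

/-- The second derivative `∂_a ∂_b f`. -/
noncomputable def mixedDeriv (a b : X) (f : X → ℂ) (p : X) : ℂ := fderiv ℂ (fun p => fderiv ℂ f p b) p a

/-- The numerator `P ∂_a ∂_b P - ∂_a P ∂_b P` of `∂_a ∂_b log P`. -/
noncomputable def logHessianNum (a b : X) (P : X → ℂ) (p : X) : ℂ :=
  P p * mixedDeriv a b P p - fderiv ℂ P p a * fderiv ℂ P p b

lemma differentiableOn_mixedDeriv {f : X → ℂ} {W : Set X} (hW : IsOpen W)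
    (hf : DifferentiableOn ℂ f W) (a b : X) : DifferentiableOn ℂ (mixedDeriv a b f) W :=
  differentiableOn_fderiv_apply hW (differentiableOn_fderiv_apply hW hf b) a

lemma differentiableOn_logHessianNum {P : X → ℂ} {W : Set X} (hW : IsOpen W)
    (hP : DifferentiableOn ℂ P W) (a b : X) : DifferentiableOn ℂ (logHessianNum a b P) W :=
  (hP.mul (differentiableOn_mixedDeriv hW hP a b)).sub
    ((differentiableOn_fderiv_apply hW hP a).mul (differentiableOn_fderiv_apply hW hP b))

/-- The mixed derivative of a logarithm `f` of `P / Q`. -/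
lemma mixedDeriv_of_exp_mul_eq {f P Q : X → ℂ} {W : Set X} (hW : IsOpen W)
    (hf : DifferentiableOn ℂ f W) (hP : DifferentiableOn ℂ P W) (hQ : DifferentiableOn ℂ Q W)
    (h : ∀ p ∈ W, Complex.exp (f p) * Q p = P p) (a b : X) {p : X} (hp : p ∈ W) :
    P p ^ 2 * Q p ^ 2 * mixedDeriv a b f p =
      Q p ^ 2 * logHessianNum a b P p - P p ^ 2 * logHessianNum a b Q p := by
  -- Multiplying by Q eliminates the exponential, so this identity can be differentiated again
  -- without dividing by P or Q.
  have hfirst : ∀ v : X, ∀ q ∈ W, fderiv ℂ P q v * Q q =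
      P q * Q q * fderiv ℂ f q v + P q * fderiv ℂ Q q v := by
    intro v q hq
    have hfq := (hf.differentiableAt (hW.mem_nhds hq)).hasFDerivAt
    have hQq := (hQ.differentiableAt (hW.mem_nhds hq)).hasFDerivAt
    have hPq := (hfq.cexp.mul hQq).congr_of_eventuallyEq (f₁ := P) (by
      filter_upwards [hW.mem_nhds hq] with x hx using (h x hx).symm)
    rw [hPq.fderiv, ← h q hq]
    simp
    ring
  have hW' := hW.mem_nhds hp
  have hdd : ∀ {g : X → ℂ}, DifferentiableOn ℂ g W → ∀ v,
      HasFDerivAt (fun q => fderiv ℂ g q v) (fderiv ℂ (fun q => fderiv ℂ g q v) p) p :=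
    fun hg v => ((differentiableOn_fderiv_apply hW hg v).differentiableAt hW').hasFDerivAt
  have hfp := (hf.differentiableAt hW').hasFDerivAt
  have hPp := (hP.differentiableAt hW').hasFDerivAt
  have hQp := (hQ.differentiableAt hW').hasFDerivAt
  have hL := (hdd hP b).mul hQp
  have hR := ((hPp.mul hQp).mul (hdd hf b)).add (hPp.mul (hdd hQ b))
  have heq := hL.unique (hR.congr_of_eventuallyEq (by
    filter_upwards [hW'] with q hq using hfirst b q hq))
  have hsecond := DFunLike.congr_fun heq a
  simp only [add_apply, smul_apply, smul_eq_mul,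
    Pi.mul_apply] at hsecond
  have h1 := hfirst a p hp
  have h2 := hfirst b p hp
  simp only [logHessianNum, mixedDeriv]
  linear_combination (-(P p * Q p)) * hsecond +
    (fderiv ℂ P p a * Q p + P p * fderiv ℂ Q p a) * h2

end LogarithmicHessian

/-! ### Wirtinger derivatives on the diagonal. -/

section Wirtinger

variable {m : ℕ}

/-- Chain rule along the real-linear embedding w ↦ (w, w̄); Wirtinger's combinations then isolate
the derivative in one factor. -/
lemma fderiv_diag {f : (Fin m → ℂ) × (Fin m → ℂ) → ℂ} {w : Fin m → ℂ}
    (hf : DifferentiableAt ℂ f (w, star w)) (v : Fin m → ℂ) :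
    fderiv ℝ (fun w => f (w, star w)) w v = fderiv ℂ f (w, star w) (v, star v) := by
  have h1 : HasFDerivAt (fun w : Fin m → ℂ => (w, star w))
      ((ContinuousLinearMap.id ℝ (Fin m → ℂ)).prod
        (starL' ℝ : (Fin m → ℂ) ≃L[ℝ] (Fin m → ℂ)).toContinuousLinearMap) w :=
    (hasFDerivAt_id w).prodMk (starL' ℝ : (Fin m → ℂ) ≃L[ℝ] (Fin m → ℂ)).hasFDerivAt
  have h2 := (hf.hasFDerivAt.restrictScalars ℝ).comp (f := fun w : Fin m → ℂ => (w, star w)) w h1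
  have h3 := h2.fderiv
  rw [show (fun w => f (w, star w)) = f ∘ fun w : Fin m → ℂ => (w, star w) from rfl, h3]
  rfl

lemma fderiv_diag_single_one {f : (Fin m → ℂ) × (Fin m → ℂ) → ℂ} {w : Fin m → ℂ}
    (hf : DifferentiableAt ℂ f (w, star w)) (i : Fin m) :
    fderiv ℝ (fun w => f (w, star w)) w (Pi.single i 1) =
      fderiv ℂ f (w, star w) (Pi.single i 1, 0) + fderiv ℂ f (w, star w) (0, Pi.single i 1) := by
  rw [fderiv_diag hf, ← map_add]
  congr 1
  ext k <;> by_cases hk : k = i <;> simp [hk]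

lemma fderiv_diag_single_I {f : (Fin m → ℂ) × (Fin m → ℂ) → ℂ} {w : Fin m → ℂ}
    (hf : DifferentiableAt ℂ f (w, star w)) (i : Fin m) :
    fderiv ℝ (fun w => f (w, star w)) w (Pi.single i Complex.I) =
      Complex.I * (fderiv ℂ f (w, star w) (Pi.single i 1, 0) -
        fderiv ℂ f (w, star w) (0, Pi.single i 1)) := by
  rw [fderiv_diag hf, ← map_sub, ← smul_eq_mul, ← map_smul]
  congr 1
  ext k <;> by_cases hk : k = i <;> simp [hk]

lemma wirtinger_diag {f : (Fin m → ℂ) × (Fin m → ℂ) → ℂ} {w : Fin m → ℂ}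
    (hf : DifferentiableAt ℂ f (w, star w)) (i : Fin m) :
    wirtinger i (fun w => f (w, star w)) w = fderiv ℂ f (w, star w) (Pi.single i 1, 0) := by
  rw [wirtinger, fderiv_diag_single_one hf, fderiv_diag_single_I hf]
  linear_combination (-1 / 2 : ℂ) * (fderiv ℂ f (w, star w) (Pi.single i 1, 0) -
        fderiv ℂ f (w, star w) (0, Pi.single i 1)) * Complex.I_mul_I

lemma wirtingerBar_diag {f : (Fin m → ℂ) × (Fin m → ℂ) → ℂ} {w : Fin m → ℂ}
    (hf : DifferentiableAt ℂ f (w, star w)) (i : Fin m) :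
    wirtingerBar i (fun w => f (w, star w)) w = fderiv ℂ f (w, star w) (0, Pi.single i 1) := by
  rw [wirtingerBar, fderiv_diag_single_one hf, fderiv_diag_single_I hf]
  linear_combination (1 / 2 : ℂ) * (fderiv ℂ f (w, star w) (Pi.single i 1, 0) -
        fderiv ℂ f (w, star w) (0, Pi.single i 1)) * Complex.I_mul_I

/-- The complex Hessian of the restriction of a sesqui-holomorphic function to the diagonal. -/
theorem complexHessian_diag {f : (Fin m → ℂ) × (Fin m → ℂ) → ℂ} {g : (Fin m → ℂ) → ℂ}
    {U : Set (Fin m → ℂ)} (hU : IsOpen U) (hf : DifferentiableOn ℂ f (conjProd U U))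
    (hg : ∀ w ∈ U, g w = f (w, star w)) {w : Fin m → ℂ} (hw : w ∈ U) (i j : Fin m) :
    complexHessian g w i j =
      mixedDeriv (Pi.single i 1, 0) (0, Pi.single j 1) f (w, star w) := by
  have hWo := isOpen_conjProd hU hU
  have hmem : ∀ x ∈ U, conjProd U U ∈ 𝓝 (x, star x) := fun x hx =>
    hWo.mem_nhds (mk_star_mem_conjProd hx hx)
  have h1 : wirtingerBar j g =ᶠ[𝓝 w]
      fun x => (fun p => fderiv ℂ f p (0, Pi.single j 1)) (x, star x) := by
    filter_upwards [hU.mem_nhds hw] with x hx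
    have hgx : g =ᶠ[𝓝 x] fun x => f (x, star x) := by
      filter_upwards [hU.mem_nhds hx] with y hy using hg y hy
    rw [← wirtingerBar_diag (hf.differentiableAt (hmem x hx)) j, wirtingerBar, wirtingerBar,
      hgx.fderiv_eq]
  have hd := (differentiableOn_fderiv_apply hWo hf (0, Pi.single j 1)).differentiableAt (hmem w hw)
  rw [mixedDeriv, ← wirtinger_diag hd i]
  simp only [complexHessian, Matrix.of_apply, wirtinger]
  rw [h1.fderiv_eq]

end Wirtinger

/-! ### Entrywise operations on positive semidefinite matrices. -/

section Matrices

variable {n : Type*} [Fintype n]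

lemma posSemidef_of_tendsto {ι : Type*} {l : Filter ι} [l.NeBot] {A : ι → Matrix n n ℂ}
    {B : Matrix n n ℂ} (hA : ∀ᶠ i in l, (A i).PosSemidef)
    (h : ∀ a b, Tendsto (fun i => A i a b) l (𝓝 (B a b))) : B.PosSemidef := by
  refine Matrix.PosSemidef.of_dotProduct_mulVec_nonneg ?_ fun x => ?_
  · ext a b
    refine tendsto_nhds_unique ((continuous_star.tendsto _).comp (h b a)) ((h a b).congr' ?_)
    filter_upwards [hA] with i hi using (hi.isHermitian.apply a b).symm
  · have ht : Tendsto (fun i => star x ⬝ᵥ (A i).mulVec x) l (𝓝 (star x ⬝ᵥ B.mulVec x)) := by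
      simp only [dotProduct, Matrix.mulVec]
      exact tendsto_finsetSum _ fun a _ => (tendsto_finsetSum _ fun b _ =>
        (h a b).mul_const _).const_mul _
    exact ge_of_tendsto ht (hA.mono fun i hi => hi.dotProduct_mulVec_nonneg x)

lemma posSemidef_inner {H : Type*} [NormedAddCommGroup H] [InnerProductSpace ℂ H] (v : n → H) :
    (Matrix.of fun i j => inner ℂ (v j) (v i)).PosSemidef :=
  (Matrix.posSemidef_gram ℂ v).transpose

lemma posSemidef_one : (Matrix.of fun _ _ : n => (1 : ℂ)).PosSemidef := by
  have := posSemidef_inner (n := n) fun _ => (1 : ℂ)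
  simpa using this

lemma posSemidef_pow {A : Matrix n n ℂ} (hA : A.PosSemidef) (k : ℕ) :
    (Matrix.of fun i j => A i j ^ k).PosSemidef := by
  induction k with
  | zero => simpa using posSemidef_one
  | succ k ih => simpa only [pow_succ] using! ih.hadamard hA

/-- By the Schur product theorem, partial sums of the entrywise exponential series are positive
semidefinite, and this passes to limits. -/
lemma posSemidef_exp {A : Matrix n n ℂ} (hA : A.PosSemidef) :
    (Matrix.of fun i j => Complex.exp (A i j)).PosSemidef := by
  refine posSemidef_of_tendsto (l := atTop)
    (A := fun N => ∑ k ∈ Finset.range N,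
      ((k.factorial : ℝ)⁻¹ : ℝ) • (Matrix.of fun i j => A i j ^ k))
    (.of_forall fun N => Matrix.posSemidef_sum _ fun k _ =>
      (posSemidef_pow hA k).smul (by positivity)) fun a b => ?_
  have := (NormedSpace.expSeries_div_hasSum_exp (A a b)).tendsto_sum_nat
  rw [← Complex.exp_eq_exp_ℂ] at this
  refine this.congr fun N => ?_
  rw [Matrix.sum_apply]
  refine Finset.sum_congr rfl fun k _ => ?_
  simp [div_eq_inv_mul]

end Matrices

/-! ### Conditionally positive definite kernels and their exponentials. -/

section Kernels

variable {m : ℕ} {B : Set (Fin m → ℂ)} {ℓ : (Fin m → ℂ) → (Fin m → ℂ) → ℂ} {w₀ : Fin m → ℂ}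

/-- The double difference of a kernel based at `w₀`. -/
def doubleDifference (w₀ : Fin m → ℂ) (ℓ : (Fin m → ℂ) → (Fin m → ℂ) → ℂ)
    (z w : Fin m → ℂ) : ℂ :=
  ℓ z w - ℓ z w₀ - ℓ w₀ w + ℓ w₀ w₀

/-- Adjoin w₀ to the points; the double difference is the congruence of the larger matrix by the
columns e_j - e_{w₀}. -/
lemma IsPosDefKernel.doubleDifference (hw₀ : w₀ ∈ B) (h : IsPosDefKernel B ℓ) :
    IsPosDefKernel B (doubleDifference w₀ ℓ) := by
  intro n u hu
  have h1 := h (n + 1) (Fin.cons w₀ u) (by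
    intro i; refine Fin.cases ?_ (fun i => ?_) i
    · simpa using hw₀
    · simpa using hu i)
  set C : Matrix (Fin (n + 1)) (Fin n) ℂ :=
    Matrix.of fun i j => Fin.cons (α := fun _ => ℂ) (-1) (fun i' => if i' = j then 1 else 0) i with hC
  convert h1.conjTranspose_mul_mul_same C using 1
  ext i j
  simp [Matrix.mul_apply, Fin.sum_univ_succ, hC, CowenDouglas.doubleDifference,
    Matrix.conjTranspose_apply, Finset.sum_add_distrib, add_mul, apply_ite (starRingEnd ℂ)]
  ring

/-- The generator of a semigroup of positive definite kernels is conditionally positive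
definite. -/
lemma isPosDefKernel_doubleDifference_of_exp (hw₀ : w₀ ∈ B)
    (h : ∀ t : ℝ, 0 < t → IsPosDefKernel B fun z w => Complex.exp ((t : ℂ) * ℓ z w)) :
    IsPosDefKernel B (doubleDifference w₀ ℓ) := by
  intro n u hu
  -- At t = 0 the double difference of exp(tℓ) is 1 - 1 - 1 + 1 = 0, so dividing by t yields its
  -- derivative, the double difference of ℓ, in the limit.
  refine posSemidef_of_tendsto (l := 𝓝[>] (0 : ℝ)) (A := fun t => t⁻¹ • Matrix.of fun i j =>
    doubleDifference w₀ (fun z w => Complex.exp ((t : ℂ) * ℓ z w)) (u i) (u j)) ?_ fun i j => ?_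
  · filter_upwards [self_mem_nhdsWithin] with t ht
    exact ((h t ht).doubleDifference hw₀ n u hu).smul (inv_nonneg.mpr (le_of_lt ht))
  · have hd : HasDerivAt (fun t : ℝ => doubleDifference w₀
        (fun z w => Complex.exp ((t : ℂ) * ℓ z w)) (u i) (u j))
        (doubleDifference w₀ ℓ (u i) (u j)) 0 := by
      have hexp : ∀ c : ℂ, HasDerivAt (fun t : ℝ => Complex.exp ((t : ℂ) * c)) c 0 := by
        intro c
        have h1 : HasDerivAt (fun t : ℝ => (t : ℂ) * c) c 0 := by
          simpa using (Complex.ofRealCLM.hasDerivAt (x := (0 : ℝ))).mul_const c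
        simpa using h1.cexp
      exact (((hexp _).sub (hexp _)).sub (hexp _)).add (hexp _)
    have := hd.tendsto_slope_zero_right
    simpa [doubleDifference] using this

/-- Schoenberg's theorem for the exponential of a conditionally positive definite kernel. -/
lemma isPosDefKernel_exp (hherm : ∀ z ∈ B, ℓ w₀ z = star (ℓ z w₀)) (hw₀ : w₀ ∈ B)
    (h : IsPosDefKernel B (doubleDifference w₀ ℓ)) {t : ℝ} (ht : 0 < t) :
    IsPosDefKernel B fun z w => Complex.exp ((t : ℂ) * ℓ z w) := by
  intro n u hu
  have h1 := posSemidef_exp ((h n u hu).smul ht.le)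
  -- ℓ exceeds its double difference by a function of z plus a function of w. Giving each half of
  -- ℓ(w₀, w₀) makes them conjugate, so the correction is a diagonal congruence.
  set α : Fin n → ℂ := fun i => Complex.exp (t * (ℓ (u i) w₀ - ℓ w₀ w₀ / 2)) with hα
  convert h1.mul_mul_conjTranspose_same (Matrix.diagonal α) using 1
  ext i j
  have hstar : star (α j) = Complex.exp (t * (ℓ w₀ (u j) - ℓ w₀ w₀ / 2)) := by
    have h2 : (starRingEnd ℂ) (ℓ w₀ w₀) = ℓ w₀ w₀ := (hherm w₀ hw₀).symm
    have h3 : (starRingEnd ℂ) (ℓ (u j) w₀) = ℓ w₀ (u j) := (hherm _ (hu j)).symm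
    rw [hα, Complex.star_def, ← Complex.exp_conj]
    simp [h2, h3, map_ofNat]
  rw [Matrix.diagonal_conjTranspose, Matrix.mul_diagonal, Matrix.diagonal_mul, Pi.star_apply,
    hstar, hα]
  simp only [Matrix.of_apply, Matrix.smul_apply, Complex.real_smul]
  rw [← Complex.exp_add, ← Complex.exp_add]
  congr 1
  simp only [doubleDifference]
  ring

end Kernels

/-! ### Factorization of positive definite kernels. -/

section Gram

/-- Every positive semidefinite kernel is a Gram kernel. -/
theorem exists_gram {X : Type} (k : X → X → ℂ)
    (hk : ∀ (n : ℕ) (u : Fin n → X), (Matrix.of fun i j => k (u i) (u j)).PosSemidef) :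
    ∃ (H : Type) (_ : NormedAddCommGroup H) (_ : InnerProductSpace ℂ H) (_ : CompleteSpace H)
      (φ : X → H), ∀ x y, inner ℂ (φ y) (φ x) = k x y := by
  have hherm : ∀ x y, star (k y x) = k x y := by
    intro x y
    have := (hk 2 ![x, y]).isHermitian.apply 0 1
    simpa using this
  -- The arguments are swapped because ⟨k_y, k_x⟩ reads the operator kernel at (y, x), which has to
  -- be k x y.
  set K : Matrix X X (ℂ →L[ℂ] ℂ) := Matrix.of fun x y => k y x • ContinuousLinearMap.id ℂ ℂ with hK
  have hpos : K.PosSemidef := by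
    have htfae := (RKHS.posSemidef_tfae (K := K)).out 0 2
    refine htfae.mpr ⟨?_, fun vv => ?_⟩
    · have hid : ContinuousLinearMap.adjoint (ContinuousLinearMap.id ℂ ℂ) = .id ℂ ℂ :=
        ((ContinuousLinearMap.eq_adjoint_iff _ _).mpr fun _ _ => rfl).symm
      ext x y
      simp [hK, Matrix.conjTranspose_apply, ← hherm y x, ContinuousLinearMap.star_eq_adjoint, hid]
    · set e := vv.support.equivFin
      have h0 := (hk _ fun i => ((e.symm i : vv.support) : X)).dotProduct_mulVec_nonneg
        fun i => star (vv (e.symm i))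
      have h1 : (vv.sum fun x w => vv.sum fun x' w' => inner ℂ (K x' x w) w') =
          ∑ x : vv.support, ∑ x' : vv.support, vv x' * (k x' x * star (vv x)) := by
        simp only [Finsupp.sum]
        rw [← Finset.sum_coe_sort]
        refine Finset.sum_congr rfl fun x _ => ?_
        rw [← Finset.sum_coe_sort]
        refine Finset.sum_congr rfl fun x' _ => ?_
        simp [hK, ← hherm (x' : X) x]
      rw [h1, Finset.sum_comm]
      have h2 : ∑ x' : vv.support, ∑ x : vv.support, vv x' * (k x' x * star (vv x)) =
          star (fun i => star (vv (e.symm i))) ⬝ᵥ Matrix.mulVec (Matrix.of fun i j =>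
            k ((e.symm i : vv.support) : X) ((e.symm j : vv.support) : X))
            (fun i => star (vv (e.symm i))) := by
        simp only [dotProduct, Matrix.mulVec, Matrix.of_apply, Pi.star_apply, star_star,
          Finset.mul_sum]
        rw [← Equiv.sum_comp e.symm]
        refine Finset.sum_congr rfl fun i _ => ?_
        rw [← Equiv.sum_comp e.symm]
      rw [h2]
      exact (Complex.le_def.mp h0).1
  have : Fact K.PosSemidef := ⟨hpos⟩
  refine ⟨RKHS.OfKernel K, inferInstance, inferInstance, inferInstance,
    fun x => RKHS.kerFun (RKHS.OfKernel K) x 1, fun x y => ?_⟩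
  rw [← RKHS.kernel_inner, RKHS.OfKernel.kernel_ofKernel]
  simp [hK, ← hherm x y]

/-- A positive definite sesqui-holomorphic matrix kernel is the Gram kernel of a family of
holomorphic Hilbert space valued maps. -/
theorem exists_holomorphic_gram {E ι : Type} [NormedAddCommGroup E] [NormedSpace ℂ E]
    [StarAddMonoid E] [ContinuousStar E] {B : Set E} (hB : IsOpen B)
    {L : E → E → ι → ι → ℂ}
    (hL : ∀ k l, DifferentiableOn ℂ (fun p : E × E => L p.1 (star p.2) k l) (conjProd B B))
    (hpos : ∀ (n : ℕ) (u : Fin n → E) (c : Fin n → ι), (∀ i, u i ∈ B) →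
      (Matrix.of fun i j => L (u i) (u j) (c i) (c j)).PosSemidef) :
    ∃ (H : Type) (_ : NormedAddCommGroup H) (_ : InnerProductSpace ℂ H) (_ : CompleteSpace H)
      (φ : ι → E → H), (∀ k, DifferentiableOn ℂ (φ k) B) ∧
        ∀ k l, ∀ z ∈ B, ∀ w ∈ B, inner ℂ (φ l w) (φ k z) = L z w k l := by
  classical
  obtain ⟨H, i1, i2, i3, φ₀, hφ₀⟩ := exists_gram (X := B × ι)
    (fun x y => L x.1 y.1 x.2 y.2) fun n u =>
      hpos n (fun i => (u i).1) (fun i => (u i).2) fun i => (u i).1.2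
  set φ : ι → E → H := fun k z => if hz : z ∈ B then φ₀ (⟨z, hz⟩, k) else 0 with hφ
  have hin : ∀ k l, ∀ z ∈ B, ∀ w ∈ B, inner ℂ (φ l w) (φ k z) = L z w k l := by
    intro k l z hz w hw
    simp only [hφ, hz, hw, dif_pos]
    exact hφ₀ (⟨z, hz⟩, k) (⟨w, hw⟩, l)
  refine ⟨H, i1, i2, i3, φ, fun k z hz => ?_, hin⟩
  have hcont : ContinuousAt (fun x => L x x k k) z := by
    have h1 : ContinuousAt (fun p : E × E => L p.1 (star p.2) k k) (z, star z) :=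
      ((hL k k).differentiableAt ((isOpen_conjProd hB hB).mem_nhds
        (mk_star_mem_conjProd hz hz))).continuousAt
    have h2 := ContinuousAt.comp (f := fun x : E => (x, star x)) h1
      (continuous_id.prodMk continuous_star).continuousAt
    simpa [Function.comp_def] using h2
  have hev : ∀ᶠ x in 𝓝 z, ‖L x x k k‖ < ‖L z z k k‖ + 1 :=
    hcont.norm.eventually (gt_mem_nhds (by linarith))
  obtain ⟨s, hs, hsub⟩ := Metric.mem_nhds_iff.mp (inter_mem (hB.mem_nhds hz) hev)
  refine (differentiableAt_of_weak (S := φ k '' B) hs (C := √(‖L z z k k‖ + 1))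
    (fun x hx => ?_) ?_ fun x hx => Submodule.le_topologicalClosure _
      (Submodule.subset_span ⟨x, (hsub hx).1, rfl⟩)).differentiableWithinAt
  · refine Real.le_sqrt_of_sq_le ?_
    have h3 := congrArg norm (hin k k x (hsub hx).1 x (hsub hx).1)
    rw [inner_self_eq_norm_sq_to_K] at h3
    have h4 : ‖φ k x‖ ^ 2 = ‖L x x k k‖ := by rw [← h3]; simp
    rw [h4]
    exact (hsub hx).2.le
  · rintro _ ⟨w, hw, rfl⟩
    refine DifferentiableOn.congr (f := fun x => L x w k k) ?_ fun x hx =>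
      hin k k x (hsub hx).1 w hw
    have := (hL k k).comp (f := fun x => (x, star w)) (s := ball z s) (by fun_prop) fun x hx =>
      mk_star_mem_conjProd (hsub hx).1 hw
    simpa [Function.comp_def] using this

end Gram

/-! ### Passing between a kernel and its mixed derivatives by integration and differentiation. -/

section Potential

variable {m : ℕ}

lemma mixedDeriv_eq_sum {f : (Fin m → ℂ) × (Fin m → ℂ) → ℂ} {W : Set ((Fin m → ℂ) × (Fin m → ℂ))}
    (hW : IsOpen W) (hf : DifferentiableOn ℂ f W) (a b : Fin m → ℂ)
    {p : (Fin m → ℂ) × (Fin m → ℂ)} (hp : p ∈ W) :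
    mixedDeriv (a, 0) (0, b) f p = ∑ k, ∑ l, a k * b l *
      mixedDeriv (Pi.single k 1, 0) (0, Pi.single l 1) f p := by
  have ha : (a, (0 : Fin m → ℂ)) = ∑ k, a k • (Pi.single k 1, (0 : Fin m → ℂ)) := by
    refine Prod.ext ?_ ?_
    · simp only [Prod.fst_sum, Prod.smul_fst]
      exact pi_eq_sum_univ' a
    · simp [Prod.snd_sum]
  have hb : ((0 : Fin m → ℂ), b) = ∑ l, b l • ((0 : Fin m → ℂ), Pi.single l (1 : ℂ)) := by
    refine Prod.ext ?_ ?_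
    · simp [Prod.fst_sum]
    · simp only [Prod.snd_sum, Prod.smul_snd]
      exact pi_eq_sum_univ' b
  have h1 : (fun p => fderiv ℂ f p (0, b)) =
      fun p => ∑ l, b l • fderiv ℂ f p (0, Pi.single l 1) := by
    funext p
    rw [hb, map_sum]
    simp only [map_smul]
  have hd : ∀ l, DifferentiableAt ℂ (fun p => fderiv ℂ f p (0, Pi.single l 1)) p := fun l =>
    (differentiableOn_fderiv_apply hW hf _).differentiableAt (hW.mem_nhds hp)
  have h2 : fderiv ℂ (fun p => ∑ l, b l • fderiv ℂ f p (0, Pi.single l 1)) p =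
      ∑ l, b l • fderiv ℂ (fun p => fderiv ℂ f p (0, Pi.single l 1)) p := by
    rw [fderiv_fun_sum fun l _ => (hd l).fun_const_smul (b l)]
    exact Finset.sum_congr rfl fun l _ => fderiv_fun_const_smul (hd l) (b l)
  rw [mixedDeriv, h1, h2, ha, map_sum]
  refine Finset.sum_congr rfl fun k _ => ?_
  rw [map_smul]
  simp only [sum_apply, smul_apply, smul_eq_mul, Finset.mul_sum, mixedDeriv]
  exact Finset.sum_congr rfl fun l _ => by ring

variable {H : Type*} [NormedAddCommGroup H] [InnerProductSpace ℂ H]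

/-- The derivative along the segment from `w₀` to `z` of a potential with gradient `φ`. -/
noncomputable def segmentDeriv (w₀ : Fin m → ℂ) (φ : Fin m → (Fin m → ℂ) → H) (z : Fin m → ℂ) (s : ℝ) : H :=
  ∑ k, (z - w₀) k • φ k (line w₀ (z - w₀) s)

lemma line_mem_of_convex {B : Set (Fin m → ℂ)} (hB : Convex ℝ B) {w₀ z : Fin m → ℂ} (hw₀ : w₀ ∈ B)
    (hz : z ∈ B) {s : ℝ} (hs : s ∈ uIcc (0 : ℝ) 1) : line w₀ (z - w₀) s ∈ B := by
  rw [uIcc_of_le zero_le_one] at hs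
  have := hB.add_smul_sub_mem hw₀ hz hs
  simpa [line] using this

variable [CompleteSpace H]

/-- The fundamental theorem of calculus applied twice, along the segment to z and then along the
segment to w; the four endpoint values of ℓ form the double difference. -/
lemma inner_integral_segmentDeriv {B : Set (Fin m → ℂ)} (hB : IsOpen B) (hBc : Convex ℝ B)
    {ℓ : (Fin m → ℂ) → (Fin m → ℂ) → ℂ} (hℓ : IsSesquiholomorphic B ℓ)
    {φ : Fin m → (Fin m → ℂ) → H} (hφ : ∀ k, DifferentiableOn ℂ (φ k) B)
    (hin : ∀ k l, ∀ z ∈ B, ∀ w ∈ B, inner ℂ (φ l w) (φ k z) =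
      mixedDeriv (Pi.single k 1, 0) (0, Pi.single l 1) (fun p => ℓ p.1 (star p.2)) (z, star w))
    {w₀ z w : Fin m → ℂ} (hw₀ : w₀ ∈ B) (hz : z ∈ B) (hw : w ∈ B) :
    inner ℂ (∫ t in (0 : ℝ)..1, segmentDeriv w₀ φ w t) (∫ s in (0 : ℝ)..1, segmentDeriv w₀ φ z s) =
      doubleDifference w₀ ℓ z w := by
  set f : (Fin m → ℂ) × (Fin m → ℂ) → ℂ := fun p => ℓ p.1 (star p.2) with hf
  have hfd : DifferentiableOn ℂ f (conjProd B B) := hℓ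
  have hWo := isOpen_conjProd hB hB
  have hcont : ∀ x ∈ B, ContinuousOn (segmentDeriv w₀ φ x) (uIcc (0 : ℝ) 1) := by
    intro x hx
    refine continuousOn_finsetSum _ fun k _ => ContinuousOn.const_smul ?_ _
    exact (hφ k).continuousOn.comp
      ((continuous_line w₀ (x - w₀)).comp Complex.continuous_ofReal).continuousOn
      fun s hs => line_mem_of_convex hBc hw₀ hx hs
  have hint : ∀ x ∈ B, IntervalIntegrable (segmentDeriv w₀ φ x) MeasureTheory.volume 0 1 :=
    fun x hx => (hcont x hx).intervalIntegrable
  set a := z - w₀ with ha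
  set b := w - w₀ with hb
  have hline1 : ∀ (s : ℝ) (v : Fin m → ℂ), line (w₀, v) (a, 0) (s : ℂ) = (line w₀ a s, v) := by
    intro s v; simp [line]
  have hline2 : ∀ (t : ℝ) (x : Fin m → ℂ),
      line (x, star w₀) (0, star b) (t : ℂ) = (x, star (line w₀ b t)) := by
    intro t x
    rw [star_line, Complex.star_def, Complex.conj_ofReal]
    simp [line]
  set A : ℝ → ℝ → ℂ := fun s t => fderiv ℂ f (line w₀ a s, star (line w₀ b t)) (0, star b) with hA
  have hAs : ∀ t ∈ uIcc (0 : ℝ) 1,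
      A 1 t - A 0 t = inner ℂ (segmentDeriv w₀ φ w t) (∫ s in (0 : ℝ)..1, segmentDeriv w₀ φ z s) := by
    intro t ht
    have hwt := line_mem_of_convex hBc hw₀ hw ht
    have hderiv : ∀ s ∈ uIcc (0 : ℝ) 1, HasDerivAt (fun s => A s t)
        (inner ℂ (segmentDeriv w₀ φ w t) (segmentDeriv w₀ φ z s)) s := by
      intro s hs
      have hzs := line_mem_of_convex hBc hw₀ hz hs
      have hd : DifferentiableAt ℂ (fun p => fderiv ℂ f p (0, star b))
          (line (w₀, star (line w₀ b t)) (a, 0) (s : ℂ)) := by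
        rw [hline1]
        exact (differentiableOn_fderiv_apply hWo hfd _).differentiableAt
          (hWo.mem_nhds (mk_star_mem_conjProd hzs hwt))
      have h1 := (hasDerivAt_comp_line hd).comp_ofReal
      simp only [hline1] at h1
      convert h1 using 1
      change _ = mixedDeriv (a, 0) (0, star b) f _
      rw [mixedDeriv_eq_sum hWo hfd a (star b) (mk_star_mem_conjProd hzs hwt)]
      simp only [segmentDeriv, sum_inner, inner_sum, inner_smul_left, inner_smul_right,
        Finset.mul_sum]
      refine Finset.sum_congr rfl fun k _ => Finset.sum_congr rfl fun l _ => ?_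
      rw [hin k l _ hzs _ hwt, Pi.star_apply, Complex.star_def]
      ring
    rw [← intervalIntegral.integral_eq_sub_of_hasDerivAt hderiv
      (((innerSL ℂ (segmentDeriv w₀ φ w t)).continuous.comp_continuousOn
        (hcont z hz)).intervalIntegrable)]
    exact (innerSL ℂ (segmentDeriv w₀ φ w t)).intervalIntegral_comp_comm (hint z hz)
  set ψz := ∫ s in (0 : ℝ)..1, segmentDeriv w₀ φ z s with hψz
  -- Pairing in the conjugate-linear slot is only real-linear, which suffices to commute with the
  -- integral over real t.
  let T : H →L[ℝ] ℂ :=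
    (Complex.conjCLE : ℂ →L[ℝ] ℂ).comp ((innerSL ℂ ψz).restrictScalars ℝ)
  have hT : ∀ x, T x = inner ℂ x ψz := fun x => inner_conj_symm _ _
  have hderiv : ∀ t ∈ uIcc (0 : ℝ) 1, HasDerivAt
      (fun t : ℝ => ℓ z (line w₀ b t) - ℓ w₀ (line w₀ b t)) (T (segmentDeriv w₀ φ w t)) t := by
    intro t ht
    have hwt := line_mem_of_convex hBc hw₀ hw ht
    have hx : ∀ x ∈ B, HasDerivAt (fun t : ℝ => ℓ x (line w₀ b t))
        (fderiv ℂ f (x, star (line w₀ b t)) (0, star b)) t := by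
      intro x hx
      have hd : DifferentiableAt ℂ f (line (x, star w₀) (0, star b) (t : ℂ)) := by
        rw [hline2]
        exact hfd.differentiableAt (hWo.mem_nhds (mk_star_mem_conjProd hx hwt))
      have h1 := (hasDerivAt_comp_line hd).comp_ofReal
      simpa only [hline2, hf, star_star] using h1
    rw [hT, ← hAs t ht]
    have h1 : line w₀ a ((1 : ℝ) : ℂ) = z := by simp [line, ha]
    have h0 : line w₀ a ((0 : ℝ) : ℂ) = w₀ := by simp [line]
    simp only [hA, h0, h1]
    exact (hx z hz).sub (hx w₀ hw₀)
  have hfin := intervalIntegral.integral_eq_sub_of_hasDerivAt hderiv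
    ((T.continuous.comp_continuousOn (hcont w hw)).intervalIntegrable)
  rw [← hT, ← T.intervalIntegral_comp_comm (hint w hw), hfin]
  simp [line, hb, doubleDifference]
  ring

/-- A kernel whose mixed derivatives form a positive definite matrix kernel is conditionally
positive definite. -/
theorem isPosDefKernel_doubleDifference_of_mixedDeriv {B : Set (Fin m → ℂ)} (hB : IsOpen B)
    (hBc : Convex ℝ B) {ℓ : (Fin m → ℂ) → (Fin m → ℂ) → ℂ} (hℓ : IsSesquiholomorphic B ℓ)
    {L : (Fin m → ℂ) → (Fin m → ℂ) → Matrix (Fin m) (Fin m) ℂ}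
    (hL : ∀ k l, IsSesquiholomorphic B fun z w => L z w k l) (hpos : IsPosDefMatrixKernel B L)
    (hℓL : ∀ k l, ∀ z ∈ B, ∀ w ∈ B, L z w k l =
      mixedDeriv (Pi.single k 1, 0) (0, Pi.single l 1) (fun p => ℓ p.1 (star p.2)) (z, star w))
    {w₀ : Fin m → ℂ} (hw₀ : w₀ ∈ B) : IsPosDefKernel B (doubleDifference w₀ ℓ) := by
  obtain ⟨H, _, _, _, φ, hφ, hin⟩ := exists_holomorphic_gram hB (L := fun z w k l => L z w k l)
    hL fun n u c hu => (hpos n u hu).submatrix fun i => (i, c i)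
  intro n u hu
  convert posSemidef_inner fun i => ∫ s in (0 : ℝ)..1, segmentDeriv w₀ φ (u i) s using 1
  ext i j
  exact (inner_integral_segmentDeriv hB hBc hℓ hφ
    (fun k l z hz w hw => (hin k l z hz w hw).trans (hℓL k l z hz w hw)) hw₀ (hu i) (hu j)).symm

omit [CompleteSpace H] in
/-- The gradient of a Hilbert space valued potential has the mixed derivatives as Gram kernel. -/
lemma inner_fderiv_fderiv {B : Set (Fin m → ℂ)} (hB : IsOpen B)
    {ℓ : (Fin m → ℂ) → (Fin m → ℂ) → ℂ} (hℓ : IsSesquiholomorphic B ℓ) {w₀ : Fin m → ℂ}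
    (hw₀ : w₀ ∈ B) {ψ : (Fin m → ℂ) → H} (hψ : DifferentiableOn ℂ ψ B)
    (hin : ∀ z ∈ B, ∀ w ∈ B, inner ℂ (ψ w) (ψ z) = doubleDifference w₀ ℓ z w) (k l : Fin m)
    {z w : Fin m → ℂ} (hz : z ∈ B) (hw : w ∈ B) :
    inner ℂ (fderiv ℂ ψ w (Pi.single l 1)) (fderiv ℂ ψ z (Pi.single k 1)) =
      mixedDeriv (Pi.single k 1, 0) (0, Pi.single l 1) (fun p => ℓ p.1 (star p.2)) (z, star w) := by
  set f : (Fin m → ℂ) × (Fin m → ℂ) → ℂ := fun p => ℓ p.1 (star p.2) with hf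
  have hfd : DifferentiableOn ℂ f (conjProd B B) := hℓ
  have hWo := isOpen_conjProd hB hB
  set e : Fin m → ℂ := Pi.single l 1 with he
  have hse : star e = e := by
    ext i; by_cases h : i = l <;> simp [he, h]
  have hline : ∀ (t : ℝ) (x : Fin m → ℂ),
      line (x, star w) (0, e) (t : ℂ) = (x, star (line w e t)) := by
    intro t x
    rw [star_line, Complex.star_def, Complex.conj_ofReal, hse]
    simp [line]
  -- The w-derivative is taken along real t because the kernel is anti-holomorphic in w; as e has
  -- real entries, this is the derivative in direction (0, e). The remaining z-derivative is
  -- complex.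
  have hfirst : ∀ x ∈ B, inner ℂ (fderiv ℂ ψ w e) (ψ x) =
      fderiv ℂ f (x, star w) (0, e) - fderiv ℂ f (w₀, star w) (0, e) := by
    intro x hx
    have hψw : HasDerivAt (fun t : ℝ => ψ (line w e t)) (fderiv ℂ ψ w e) 0 := by
      have := (hasDerivAt_comp_line (f := ψ) (p := w) (v := e) (ζ := ((0 : ℝ) : ℂ))
        (by simpa using hψ.differentiableAt (hB.mem_nhds hw))).scomp (0 : ℝ)
          Complex.ofRealCLM.hasDerivAt
      simpa [Function.comp_def] using this
    let T : H →L[ℝ] ℂ :=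
      (Complex.conjCLE : ℂ →L[ℝ] ℂ).comp ((innerSL ℂ (ψ x)).restrictScalars ℝ)
    have hT : ∀ y, T y = inner ℂ y (ψ x) := fun y => inner_conj_symm _ _
    have h1 := T.hasFDerivAt.comp_hasDerivAt (0 : ℝ) hψw
    have h2 : ∀ y ∈ B, HasDerivAt (fun t : ℝ => ℓ y (line w e t))
        (fderiv ℂ f (y, star w) (0, e)) 0 := by
      intro y hy
      have := (hasDerivAt_comp_line (f := f) (p := (y, star w)) (v := (0, e))
        (ζ := ((0 : ℝ) : ℂ)) (by
          simpa using hfd.differentiableAt (hWo.mem_nhds (mk_star_mem_conjProd hy hw)))).comp_ofReal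
      simp only [hline] at this
      simpa [hf] using this
    have h3 : HasDerivAt (fun t : ℝ => doubleDifference w₀ ℓ x (line w e t))
        (fderiv ℂ f (x, star w) (0, e) - fderiv ℂ f (w₀, star w) (0, e)) 0 :=
      (((h2 x hx).sub_const (ℓ x w₀)).sub (h2 w₀ hw₀)).add_const (ℓ w₀ w₀)
    have hmem : ∀ᶠ t : ℝ in 𝓝 0, line w e t ∈ B := by
      have : Tendsto (fun t : ℝ => line w e (t : ℂ)) (𝓝 0) (𝓝 w) := by
        have := ((continuous_line w e).comp Complex.continuous_ofReal).tendsto (0 : ℝ)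
        simpa [Function.comp_def] using this
      exact this.eventually (hB.mem_nhds hw)
    rw [← hT]
    refine h1.unique (h3.congr_of_eventuallyEq ?_)
    filter_upwards [hmem] with t ht
    exact (hT _).trans (hin x hx _ ht)
  have h1 : HasFDerivAt (fun x => inner ℂ (fderiv ℂ ψ w e) (ψ x))
      ((innerSL ℂ (fderiv ℂ ψ w e)).comp (fderiv ℂ ψ z)) z :=
    (innerSL ℂ (fderiv ℂ ψ w e)).hasFDerivAt.comp z (hψ.differentiableAt (hB.mem_nhds hz)).hasFDerivAt
  have h2 : HasFDerivAt (fun x => fderiv ℂ f (x, star w) (0, e))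
      ((fderiv ℂ (fun p => fderiv ℂ f p (0, e)) (z, star w)).comp
        ((ContinuousLinearMap.id ℂ (Fin m → ℂ)).prod 0)) z :=
    HasFDerivAt.comp (g := fun p => fderiv ℂ f p (0, e)) z
      ((differentiableOn_fderiv_apply hWo hfd _).differentiableAt
        (hWo.mem_nhds (mk_star_mem_conjProd hz hw))).hasFDerivAt
      ((hasFDerivAt_id z).prodMk (hasFDerivAt_const (star w) z))
  have h3 := h1.unique ((h2.sub_const (fderiv ℂ f (w₀, star w) (0, e))).congr_of_eventuallyEq (by
    filter_upwards [hB.mem_nhds hz] with x hx using hfirst x hx))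
  exact DFunLike.congr_fun h3 (Pi.single k 1)

end Potential

/-! ### The two implications. -/

section Main

variable {m : ℕ} {Ω : Set (Fin m → ℂ)} {K 𝔎 : (Fin m → ℂ) → (Fin m → ℂ) → ℂ}

lemma isPosDefKernel_of_rkhs {H : Type*} [NormedAddCommGroup H] [InnerProductSpace ℂ H]
    [CompleteSpace H] [RKHS ℂ H Ω ℂ] (hK : ∀ z w : Ω, RKHS.kernel H z w 1 = K z w) :
    IsPosDefKernel Ω K := by
  intro n u hu
  have hgram : (Matrix.of fun i j : Fin n => K (u i) (u j)) =
      Matrix.gram ℂ fun i => RKHS.kerFun H (⟨u i, hu i⟩ : Ω) (1 : ℂ) := by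
    ext i j
    rw [Matrix.gram_apply, Matrix.of_apply, ← hK ⟨u i, hu i⟩ ⟨u j, hu j⟩, RKHS.kerFun_inner,
      RKHS.kerFun_apply]
    simp
  rw [hgram]
  exact Matrix.posSemidef_gram ℂ _

lemma IsPosDefKernel.symm (h : IsPosDefKernel Ω K) {z w : Fin m → ℂ} (hz : z ∈ Ω) (hw : w ∈ Ω) :
    star (K w z) = K z w := by
  have := (h 2 ![z, w] (by intro i; fin_cases i <;> simpa)).isHermitian.apply 0 1
  simpa using this

lemma IsPosDefKernel.diag_pos (h : IsPosDefKernel Ω K) {w : Fin m → ℂ} (hw : w ∈ Ω)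
    (h0 : K w w ≠ 0) : 0 < K w w := by
  have := (h 1 (fun _ => w) fun _ => hw).diag_nonneg (i := 0)
  exact lt_of_le_of_ne (by simpa using this) h0.symm

lemma IsPosDefKernel.ratio_pos (hK : IsPosDefKernel Ω K) (h𝔎 : IsPosDefKernel Ω 𝔎)
    (hK0 : ∀ w ∈ Ω, K w w ≠ 0) (h𝔎0 : ∀ w ∈ Ω, 𝔎 w w ≠ 0) {w : Fin m → ℂ} (hw : w ∈ Ω) :
    0 < (𝔎 w w)⁻¹ * K w w := by
  have h1 := hK.diag_pos hw (hK0 w hw)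
  have h2 := h𝔎.diag_pos hw (h𝔎0 w hw)
  rw [Complex.pos_iff] at h1 h2
  obtain ⟨a, ha⟩ : ∃ a : ℝ, K w w = a := ⟨_, Complex.ext rfl (by simp [← h1.2])⟩
  obtain ⟨b, hb⟩ : ∃ b : ℝ, 𝔎 w w = b := ⟨_, Complex.ext rfl (by simp [← h2.2])⟩
  rw [ha] at h1 ⊢
  rw [hb] at h2 ⊢
  have : 0 < b⁻¹ * a := mul_pos (inv_pos.mpr (by simpa using h2.1)) (by simpa using h1.1)
  exact_mod_cast this

/-- Near every point of the diagonal the principal branch of `log (𝔎⁻¹ K)` is sesqui-holomorphic. -/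
lemma exists_ball_log (hΩ : IsOpen Ω) (hKh : IsSesquiholomorphic Ω K)
    (h𝔎h : IsSesquiholomorphic Ω 𝔎) (hpos : ∀ w ∈ Ω, 0 < (𝔎 w w)⁻¹ * K w w)
    (h𝔎0 : ∀ w ∈ Ω, 𝔎 w w ≠ 0) {w₀ : Fin m → ℂ} (hw₀ : w₀ ∈ Ω) :
    ∃ r > 0, ball w₀ r ⊆ Ω ∧
      (∀ z ∈ ball w₀ r, ∀ w ∈ ball w₀ r, 𝔎 z w ≠ 0 ∧ (𝔎 z w)⁻¹ * K z w ∈ Complex.slitPlane) ∧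
      IsSesquiholomorphic (ball w₀ r) fun z w => Complex.log ((𝔎 z w)⁻¹ * K z w) := by
  set P : (Fin m → ℂ) × (Fin m → ℂ) → ℂ := fun p => K p.1 (star p.2) with hP
  set Q : (Fin m → ℂ) × (Fin m → ℂ) → ℂ := fun p => 𝔎 p.1 (star p.2) with hQ
  have hPd : DifferentiableOn ℂ P (conjProd Ω Ω) := hKh
  have hQd : DifferentiableOn ℂ Q (conjProd Ω Ω) := h𝔎h
  have hWo := isOpen_conjProd hΩ hΩ
  have hmem := hWo.mem_nhds (mk_star_mem_conjProd hw₀ hw₀)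
  have hQ0 : Q (w₀, star w₀) ≠ 0 := by simpa [hQ] using h𝔎0 w₀ hw₀
  have hQc : ContinuousAt Q (w₀, star w₀) := (hQd.differentiableAt hmem).continuousAt
  have hPc : ContinuousAt P (w₀, star w₀) := (hPd.differentiableAt hmem).continuousAt
  have hslit : (Q (w₀, star w₀))⁻¹ * P (w₀, star w₀) ∈ Complex.slitPlane := by
    have := hpos w₀ hw₀
    simp only [hP, hQ, star_star]
    exact Complex.mem_slitPlane_iff.mpr (Or.inl (Complex.pos_iff.mp this).1)
  have hev : ∀ᶠ p in 𝓝 (w₀, star w₀), Q p ≠ 0 ∧ (Q p)⁻¹ * P p ∈ Complex.slitPlane ∧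
      p ∈ conjProd Ω Ω :=
    (hQc.eventually_ne hQ0).and (((hQc.inv₀ hQ0).mul hPc).eventually
      (Complex.isOpen_slitPlane.mem_nhds hslit) |>.and hmem)
  have hcont : Tendsto (fun x : (Fin m → ℂ) × (Fin m → ℂ) => (x.1, star x.2)) (𝓝 (w₀, w₀))
      (𝓝 (w₀, star w₀)) :=
    (by fun_prop : Continuous fun x : (Fin m → ℂ) × (Fin m → ℂ) => (x.1, star x.2)).tendsto _
  obtain ⟨r, hr, hrs⟩ := Metric.mem_nhds_iff.mp (hcont.eventually hev)
  have hall : ∀ z ∈ ball w₀ r, ∀ w ∈ ball w₀ r, Q (z, star w) ≠ 0 ∧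
      (Q (z, star w))⁻¹ * P (z, star w) ∈ Complex.slitPlane ∧ (z, star w) ∈ conjProd Ω Ω :=
    fun z hz w hw => hrs (show (z, w) ∈ ball (w₀, w₀) r by
      rw [← ball_prod_same]; exact ⟨hz, hw⟩)
  have hsub : ball w₀ r ⊆ Ω := fun z hz => (hall z hz z hz).2.2.1
  refine ⟨r, hr, hsub, fun z hz w hw => ?_, fun p hp => ?_⟩
  · simpa [hP, hQ] using (⟨(hall z hz w hw).1, (hall z hz w hw).2.1⟩ : _ ∧ _)
  · have hp' : (p.1, star (star p.2)) = p := by rw [star_star]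
    have := hall p.1 hp.1 (star p.2) hp.2
    rw [hp'] at this
    have hpm := hWo.mem_nhds this.2.2
    exact ((((hQd.differentiableAt hpm).fun_inv this.1).fun_mul
      (hPd.differentiableAt hpm)).clog this.2.1).differentiableWithinAt

/-- Factor the double difference through a holomorphic ψ and take φ to be its gradient; the terms of
the double difference depending on one variable disappear under ∂ₖ∂̄ₗ. -/
lemma exists_holomorphic_gram_mixedDeriv {B : Set (Fin m → ℂ)} (hB : IsOpen B)
    {ℓ : (Fin m → ℂ) → (Fin m → ℂ) → ℂ} (hℓ : IsSesquiholomorphic B ℓ) {w₀ : Fin m → ℂ}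
    (hw₀ : w₀ ∈ B) (hpos : IsPosDefKernel B (doubleDifference w₀ ℓ)) :
    ∃ (H : Type) (_ : NormedAddCommGroup H) (_ : InnerProductSpace ℂ H) (_ : CompleteSpace H)
      (φ : Fin m → (Fin m → ℂ) → H), (∀ k, DifferentiableOn ℂ (φ k) B) ∧
        ∀ k l, ∀ z ∈ B, ∀ w ∈ B, inner ℂ (φ l w) (φ k z) =
          mixedDeriv (Pi.single k 1, 0) (0, Pi.single l 1) (fun p => ℓ p.1 (star p.2))
            (z, star w) := by
  have hdd : DifferentiableOn ℂ (fun p : (Fin m → ℂ) × (Fin m → ℂ) =>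
      doubleDifference w₀ ℓ p.1 (star p.2)) (conjProd B B) := by
    have hℓd : DifferentiableOn ℂ (fun p : (Fin m → ℂ) × (Fin m → ℂ) => ℓ p.1 (star p.2))
      (conjProd B B) := hℓ
    have h1 : DifferentiableOn ℂ (fun p : (Fin m → ℂ) × (Fin m → ℂ) => ℓ p.1 w₀)
        (conjProd B B) := by
      have := hℓd.comp (f := fun p : (Fin m → ℂ) × (Fin m → ℂ) => (p.1, star w₀))
        (s := conjProd B B) (by fun_prop) fun p hp => mk_star_mem_conjProd hp.1 hw₀
      simpa [Function.comp_def] using this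
    have h2 : DifferentiableOn ℂ (fun p : (Fin m → ℂ) × (Fin m → ℂ) => ℓ w₀ (star p.2))
        (conjProd B B) :=
      hℓd.comp (f := fun p : (Fin m → ℂ) × (Fin m → ℂ) => (w₀, p.2))
        (s := conjProd B B) (by fun_prop) fun p hp => ⟨hw₀, hp.2⟩
    exact ((hℓd.sub h1).sub h2).add_const _
  obtain ⟨H, i1, i2, i3, ψ, hψ, hin⟩ := exists_holomorphic_gram (ι := Unit) hB
    (L := fun z w _ _ => doubleDifference w₀ ℓ z w) (fun _ _ => hdd)
    fun n u _ hu => hpos n u hu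
  exact ⟨H, i1, i2, i3, fun k z => fderiv ℂ (ψ ()) z (Pi.single k 1),
    fun k => differentiableOn_fderiv_apply hB (hψ ()) _, fun k l z hz w hw =>
      inner_fderiv_fderiv hB hℓ hw₀ (hψ ()) (hin () ()) k l hz hw⟩

lemma complexHessian_log_eq {B : Set (Fin m → ℂ)} (hB : IsOpen B)
    (hlog : IsSesquiholomorphic B fun z w => Complex.log ((𝔎 z w)⁻¹ * K z w))
    {w : Fin m → ℂ} (hw : w ∈ B) (i j : Fin m) :
    complexHessian (fun w => Complex.log ((𝔎 w w)⁻¹ * K w w)) w i j =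
      mixedDeriv (Pi.single i 1, 0) (0, Pi.single j 1)
        (fun p => Complex.log ((𝔎 p.1 (star p.2))⁻¹ * K p.1 (star p.2))) (w, star w) :=
  complexHessian_diag hB hlog (fun w _ => by simp) hw i j

/-- If the complex Hessian of `log (𝔎⁻¹ K)` is positive definite, then `𝔎⁻¹ K` is infinitely
divisible near every point. -/
theorem exists_isInfinitelyDivisible_of_isPosDefFunction (hΩ : IsOpen Ω)
    (hK : IsPosDefKernel Ω K) (h𝔎 : IsPosDefKernel Ω 𝔎)
    (hKh : IsSesquiholomorphic Ω K) (h𝔎h : IsSesquiholomorphic Ω 𝔎)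
    (hK0 : ∀ w ∈ Ω, K w w ≠ 0) (h𝔎0 : ∀ w ∈ Ω, 𝔎 w w ≠ 0)
    (h : IsPosDefFunction Ω (complexHessian fun w => Complex.log ((𝔎 w w)⁻¹ * K w w)))
    {w₀ : Fin m → ℂ} (hw₀ : w₀ ∈ Ω) :
    ∃ Ω₀ : Set (Fin m → ℂ), IsOpen Ω₀ ∧ w₀ ∈ Ω₀ ∧ Ω₀ ⊆ Ω ∧
      IsInfinitelyDivisible Ω₀ fun z w => (𝔎 z w)⁻¹ * K z w := by
  obtain ⟨L, hLh, hLG, hLpos⟩ := h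
  have hpos : ∀ w ∈ Ω, 0 < (𝔎 w w)⁻¹ * K w w := fun w hw => hK.ratio_pos h𝔎 hK0 h𝔎0 hw
  obtain ⟨r, hr, hsub, hslit, hlog⟩ := exists_ball_log hΩ hKh h𝔎h hpos h𝔎0 hw₀
  have hw₀B : w₀ ∈ ball w₀ r := mem_ball_self hr
  have hWo := isOpen_conjProd (isOpen_ball (x := w₀) (ε := r)) (isOpen_ball (x := w₀) (ε := r))
  have hLB : ∀ k l, IsSesquiholomorphic (ball w₀ r) fun z w => L z w k l := fun k l =>
    (hLh k l).mono (conjProd_mono hsub hsub)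
  have hLmixed : ∀ k l, ∀ z ∈ ball w₀ r, ∀ w ∈ ball w₀ r, L z w k l =
      mixedDeriv (Pi.single k 1, 0) (0, Pi.single l 1)
        (fun p => Complex.log ((𝔎 p.1 (star p.2))⁻¹ * K p.1 (star p.2))) (z, star w) := by
    intro k l z hz w hw
    -- The hypothesis identifies L with the Hessian only on the diagonal; uniqueness of polarization
    -- gives the identity off it.
    have := eq_zero_of_diag_eq_zero isOpen_ball (convex_ball w₀ r)
      ((hLB k l).fun_sub (differentiableOn_mixedDeriv hWo hlog (Pi.single k 1, 0)
        (0, Pi.single l 1))) (fun w hw => ?_) hz hw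
    · simpa [sub_eq_zero] using this
    · rw [sub_eq_zero, ← complexHessian_log_eq isOpen_ball hlog hw k l, ← hLG w (hsub hw)]
      simp
  have hdd := isPosDefKernel_doubleDifference_of_mixedDeriv isOpen_ball (convex_ball w₀ r) hlog hLB
    (fun n u hu => hLpos n u fun i => hsub (hu i)) hLmixed hw₀B
  refine ⟨ball w₀ r, isOpen_ball, hw₀B, hsub, _, ⟨hlog, fun z hz w hw =>
    Complex.exp_log (Complex.slitPlane_ne_zero (hslit z hz w hw).2), fun w hw => ?_⟩,
    fun t ht => isPosDefKernel_exp (fun z hz => ?_) hw₀B hdd ht⟩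
  · have := hpos w (hsub hw)
    rw [Complex.log_im, Complex.arg_eq_zero_iff_zero_le]
    exact this.le
  · have h1 : (𝔎 w₀ z)⁻¹ * K w₀ z = (starRingEnd ℂ) ((𝔎 z w₀)⁻¹ * K z w₀) := by
      rw [map_mul, map_inv₀]
      exact congrArg₂ (fun a b => a⁻¹ * b) (h𝔎.symm hw₀ (hsub hz)).symm
        (hK.symm hw₀ (hsub hz)).symm
    rw [h1, Complex.log_conj _ (Complex.slitPlane_arg_ne_pi (hslit z hz w₀ hw₀B).2)]
    rfl

/-- If `𝔎⁻¹ K` is infinitely divisible on some non-empty open set, then the complex Hessian of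
`log (𝔎⁻¹ K)` is positive definite on the whole domain. -/
theorem isPosDefFunction_of_isInfinitelyDivisible (hΩ : IsOpen Ω) (hΩc : IsPreconnected Ω)
    (hpos : ∀ w ∈ Ω, 0 < (𝔎 w w)⁻¹ * K w w)
    (hKh : IsSesquiholomorphic Ω K) (h𝔎h : IsSesquiholomorphic Ω 𝔎)
    (hK0 : ∀ w ∈ Ω, K w w ≠ 0) (h𝔎0 : ∀ w ∈ Ω, 𝔎 w w ≠ 0)
    {Ω₀ : Set (Fin m → ℂ)} (hΩ₀ : IsOpen Ω₀) (hne : Ω₀.Nonempty) (hsub : Ω₀ ⊆ Ω)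
    (h : IsInfinitelyDivisible Ω₀ fun z w => (𝔎 z w)⁻¹ * K z w) :
    IsPosDefFunction Ω (complexHessian fun w => Complex.log ((𝔎 w w)⁻¹ * K w w)) := by
  obtain ⟨w₀, hw₀⟩ := hne
  obtain ⟨r, hr, hrΩ₀⟩ := Metric.isOpen_iff.mp hΩ₀ w₀ hw₀
  obtain ⟨ℓ, ⟨hℓh, hℓexp, -⟩, hℓpos⟩ := h
  -- Ω₀ may be disconnected; the continuation starts from a ball inside it.
  set B := ball w₀ r with hBdef
  have hB : IsOpen B := isOpen_ball
  have hw₀B : w₀ ∈ B := mem_ball_self hr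
  have hBΩ : B ⊆ Ω := hrΩ₀.trans hsub
  have hWΩ := isOpen_conjProd hΩ hΩ
  have hℓB : IsSesquiholomorphic B ℓ := hℓh.mono (conjProd_mono hrΩ₀ hrΩ₀)
  have hdd : IsPosDefKernel B (doubleDifference w₀ ℓ) :=
    isPosDefKernel_doubleDifference_of_exp hw₀B fun t ht n u hu =>
      hℓpos t ht n u fun i => hrΩ₀ (hu i)
  obtain ⟨H, _, _, _, φ, hφ, hin⟩ := exists_holomorphic_gram_mixedDeriv hB hℓB hw₀B hdd
  set P : (Fin m → ℂ) × (Fin m → ℂ) → ℂ := fun p => K p.1 (star p.2) with hP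
  set Q : (Fin m → ℂ) × (Fin m → ℂ) → ℂ := fun p => 𝔎 p.1 (star p.2) with hQ
  have hPd : DifferentiableOn ℂ P (conjProd Ω Ω) := hKh
  have hQd : DifferentiableOn ℂ Q (conjProd Ω Ω) := h𝔎h
  -- K and 𝔎 may vanish off the diagonal and log(K/𝔎) need not exist on Ω × Ω, so the relation is
  -- kept with denominators cleared.
  set D : (Fin m → ℂ) × (Fin m → ℂ) → ℂ := fun p => P p ^ 2 * Q p ^ 2 with hD
  set N : Fin m → Fin m → (Fin m → ℂ) × (Fin m → ℂ) → ℂ := fun k l p =>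
    Q p ^ 2 * logHessianNum (Pi.single k 1, 0) (0, Pi.single l 1) P p -
      P p ^ 2 * logHessianNum (Pi.single k 1, 0) (0, Pi.single l 1) Q p with hN
  have hDd : DifferentiableOn ℂ D (conjProd Ω Ω) := (hPd.fun_pow 2).fun_mul (hQd.fun_pow 2)
  have hNd : ∀ k l, DifferentiableOn ℂ (N k l) (conjProd Ω Ω) := fun k l =>
    ((hQd.fun_pow 2).fun_mul (differentiableOn_logHessianNum hWΩ hPd _ _)).fun_sub
      ((hPd.fun_pow 2).fun_mul (differentiableOn_logHessianNum hWΩ hQd _ _))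
  have hD0 : ∀ w ∈ Ω, D (w, star w) ≠ 0 := fun w hw => by
    simpa [hD, hP, hQ] using ⟨hK0 w hw, h𝔎0 w hw⟩
  -- Since 0⁻¹ = 0, a zero of 𝔎 would make the quotient 0, which no exponential attains; so a
  -- logarithm branch itself excludes zeros of 𝔎.
  have hexp : ∀ {z w x : ℂ}, z⁻¹ * w ≠ 0 → Complex.exp x = z⁻¹ * w → Complex.exp x * z = w := by
    intro z w x h0 hx
    have hz : z ≠ 0 := fun hz => h0 (by simp [hz])
    rw [hx]; field_simp
  have hmixed : ∀ {U : Set (Fin m → ℂ)} {f : (Fin m → ℂ) × (Fin m → ℂ) → ℂ}, IsOpen U → U ⊆ Ω →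
      DifferentiableOn ℂ f (conjProd U U) →
      (∀ p ∈ conjProd U U, Complex.exp (f p) = (Q p)⁻¹ * P p) →
      ∀ k l, ∀ z ∈ U, ∀ w ∈ U, D (z, star w) *
        mixedDeriv (Pi.single k 1, 0) (0, Pi.single l 1) f (z, star w) = N k l (z, star w) := by
    intro U f hU hUΩ hf hfe k l z hz w hw
    have hUU := conjProd_mono hUΩ hUΩ
    exact mixedDeriv_of_exp_mul_eq (isOpen_conjProd hU hU) hf (hPd.mono hUU) (hQd.mono hUU)
      (fun p hp => hexp (by rw [← hfe p hp]; exact Complex.exp_ne_zero _) (hfe p hp)) _ _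
      (mk_star_mem_conjProd hz hw)
  have hrel : ∀ k l, ∀ z ∈ B, ∀ w ∈ B,
      D (z, star w) * inner ℂ (φ l w) (φ k z) = N k l (z, star w) := by
    intro k l z hz w hw
    rw [hin k l z hz w hw]
    exact hmixed hB hBΩ hℓB
      (fun p hp => hℓexp p.1 (hrΩ₀ hp.1) (star p.2) (hrΩ₀ hp.2)) k l z hz w hw
  obtain ⟨Φ, hΦd, hΦ⟩ := exists_continuation_of_gram_relation hΩ hΩc hDd hNd hD0 hB ⟨w₀, hw₀B⟩
    (convex_ball w₀ r).isPreconnected hBΩ hφ hrel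
  refine ⟨fun z w => Matrix.of fun k l => inner ℂ (Φ l w) (Φ k z), fun k l =>
    differentiableOn_inner_conjProd hΩ hΩ (hΦd l) (hΦd k), fun w hw => ?_, fun n u _ =>
      posSemidef_inner fun p : Fin n × Fin m => Φ p.2 (u p.1)⟩
  obtain ⟨s, hs, hsΩ, hslit, hlog⟩ := exists_ball_log hΩ hKh h𝔎h hpos h𝔎0 hw
  ext i j
  have hws : w ∈ ball w s := mem_ball_self hs
  rw [complexHessian_log_eq isOpen_ball hlog hws i j]
  refine mul_left_cancel₀ (hD0 w hw) ((hΦ i j w hw w hw).trans ?_)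
  exact (hmixed isOpen_ball hsΩ hlog (fun p hp => Complex.exp_log
    (Complex.slitPlane_ne_zero (hslit p.1 hp.1 (star p.2) hp.2).2)) i j w hws w hws).symm

end Main

end CowenDouglas

theorem mainTheorem4 {m : ℕ} (hm : 1 ≤ m) (Ω : Set (Fin m → ℂ))
    (hΩ_open : IsOpen Ω) (hΩ_conn : IsConnected Ω)
    -- the reproducing kernel Hilbert space `H = H_K` of holomorphic functions on `Ω`
    {H : Type*} [NormedAddCommGroup H] [InnerProductSpace ℂ H] [CompleteSpace H] [RKHS ℂ H Ω ℂ]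
    (K : (Fin m → ℂ) → (Fin m → ℂ) → ℂ)
    (hK_kernel : ∀ z w : Ω, RKHS.kernel H z w 1 = K z w)
    (hK_holo : CowenDouglas.IsSesquiholomorphic Ω K)
    (hK_diag : ∀ w ∈ Ω, K w w ≠ 0)
    -- the tuple `M` of multiplications by the coordinate functions, with `M*` in `B_1(Ω*)`
    (M : Fin m → H →L[ℂ] H)
    (hM : ∀ (i : Fin m) (f : H) (z : Ω), M i f z = (z : Fin m → ℂ) i * f z)
    (hM_CD : CowenDouglas.IsCowenDouglas 1 {w | star w ∈ Ω}
      (fun i => ContinuousLinearMap.adjoint (M i)))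
    -- the fixed positive definite kernel
    (𝔎 : (Fin m → ℂ) → (Fin m → ℂ) → ℂ)
    (h𝔎_holo : CowenDouglas.IsSesquiholomorphic Ω 𝔎)
    (h𝔎_pos : CowenDouglas.IsPosDefKernel Ω 𝔎)
    (h𝔎_diag : ∀ w ∈ Ω, 𝔎 w w ≠ 0) :
    CowenDouglas.IsPosDefFunction Ω
        (CowenDouglas.complexHessian fun w => Complex.log ((𝔎 w w)⁻¹ * K w w)) ↔
      ∃ Ω₀ : Set (Fin m → ℂ), IsOpen Ω₀ ∧ Ω₀.Nonempty ∧ Ω₀ ⊆ Ω ∧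
        CowenDouglas.IsInfinitelyDivisible Ω₀ (fun z w => (𝔎 z w)⁻¹ * K z w) := by

  have hK_pos : CowenDouglas.IsPosDefKernel Ω K := CowenDouglas.isPosDefKernel_of_rkhs hK_kernel
  constructor
  · intro h
    obtain ⟨w₀, hw₀⟩ := hΩ_conn.nonempty
    obtain ⟨Ω₀, h1, h2, h3, h4⟩ :=
      CowenDouglas.exists_isInfinitelyDivisible_of_isPosDefFunction hΩ_open hK_pos h𝔎_pos hK_holo
        h𝔎_holo hK_diag h𝔎_diag h hw₀
    exact ⟨Ω₀, h1, ⟨w₀, h2⟩, h3, h4⟩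
  · rintro ⟨Ω₀, h1, h2, h3, h4⟩
    exact CowenDouglas.isPosDefFunction_of_isInfinitelyDivisible hΩ_open hΩ_conn.isPreconnected
      (fun w hw => hK_pos.ratio_pos h𝔎_pos hK_diag h𝔎_diag hw) hK_holo h𝔎_holo hK_diag h𝔎_diag
      h1 h2 h3 h4
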